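/- Let $\mathcal{C}$ be a (locally small) category and let $F = [P,-] : \mathcal{C} \to \mathbf{Set}$ be the functor prorepresented by a pro-object $P$ of $\mathcal{C}$, that is, $F = \operatorname{colim}_i \mathcal{C}(P_i,-)$ for a diagram $(P_i)$ in $\mathcal{C}$ indexed by a small cofiltered category. An arrow $f : X \to Y$ is a strict epimorphism if every $g : X \to Z$ such that $gs = gt$ whenever $fs = ft$ (for all $s, t : W \to X$) factors uniquely as $g = hf$. Assume: (i) every arrow of $\mathcal{C}$ is a strict epimorphism; (ii) $FX \neq \emptyset$ for every $X \in \mathcal{C}$; (iii) $F$ preserves strict epimorphisms. Let $D_{\Delta F}$ be the preordered class of all $(X, (x_0, x_1))$ with $x_0, x_1 \in FX$, where $(X,(x_0,x_1)) \leq (Y,(y_0,y_1))$ if there is $f : X \to Y$ with $F(f)(x_i) = y_i$, $i = 0, 1$. Let $G = \mathrm{lAut}(F)$ be the locale of $2$-valued sheaves on the free inf-lattice on $D_{\Delta F}$, with generators $[(X,\langle x|y\rangle)]$, for the topology generated by: the empty family covers $[(X,\langle z|x\rangle)] \wedge [(X,\langle z|y\rangle)]$ and $[(X,\langle x|z\rangle)]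 \wedge [(X,\langle y|z\rangle)]$ for $x \neq y$, $z$ in $FX$; the families $([(X,\langle z|x\rangle)])_{x \in FX}$ and $([(X,\langle x|z\rangle)])_{x \in FX}$ cover $1$ for $z \in FX$. It is a localic group with multiplication given by $m^*[(X,\langle x|y\rangle)] = \bigvee_z [(X,\langle x|z\rangle)] \otimes [(X,\langle z|y\rangle)]$. For a set $S$, the localic group $\mathrm{lAut}(S)$, with generators $[\langle s|t\rangle]$, is the case of the functor with value $S$ on the category with one arrow. A $G$-set is a set $S$ with a morphism of localic groups $\mu : G \to \mathrm{lAut}(S)$; a morphism of $G$-sets is a function $h : S \to T$ with $\mu^*[\langle s|s'\rangle] \leq \mu^*[\langle h(s)|h(s')\rangle]$ for all $s, s' \in S$; this defines the category $\mathcal{B}G$. A $G$-set is transitive if $\mu^*[\langle s|s'\rangle] \neq 0$ for all $s, s' \in S$. The functor $\mu F : \mathcal{C} \to \mathcal{B}G$ sends $X$ to the set $FX$ with the action $[\langle x|y\rangle] \mapsto [(X,\langle x|y\rangle)]$. Then $\mu F$ takes values in the nonempty transitive $G$-sets. If moreover $\mathcal{C}$ is small, then $G$ is small, and: (a) if $\mathcal{C}$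 is not equivalent to the category with a single arrow, then $\mu F$ induces an equivalence of categories $\mathcal{C}^{\sim} \simeq \mathcal{B}G$, where $\mathcal{C}^{\sim}$ is the topos of sheaves on $\mathcal{C}$ for the canonical topology; (b) in all cases, the atomic topology on $\mathcal{C}$ (the covering sieves are the nonempty ones) is defined, that is, any two arrows of $\mathcal{C}$ with the same codomain complete to a commutative square, and $\mu F$ induces an equivalence between the topos of sheaves on $\mathcal{C}$ for the atomic topology and $\mathcal{B}G$. Here "$\mu F$ induces an equivalence" means that there is an equivalence whose inverse $\mathcal{B}G \to \mathcal{C}^{\sim}$ is $S \mapsto \mathcal{B}G(\mu F(-), S)$, and which sends the representable sheaf $\mathcal{C}(-,X)$ to $\mu F(X)$, naturally in $X$. -/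

import Mathlib

namespace LocalicGalois

open CategoryTheory Limits Opposite

universe w w' v u v₁

/-! ### Locales of `2`-valued sheaves on an inf-lattice with basic covers -/

section Site

variable {D : Type w} [SemilatticeInf D]

/-- The locale `D^~` of `2`-valued sheaves on an inf-lattice `D` for the topology generated by
the basic covers `cov` (`cov u S` says that the family of all `s ∈ S` covers `u`), as a
sublocale of the locale `D^∧` of downward closed subsets: those `T` which satisfy the sheaf condition for
every pullback `(s ⊓ v → u ⊓ v)` of a basic cover. -/
def sheaves (cov : D → Set D → Prop) : Sublocale (LowerSet D) where
  carrier := {T | ∀ u S, cov u S → ∀ v, (∀ s ∈ S, s ⊓ v ∈ T) → u ⊓ v ∈ T}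
  sInf_mem' A hA u S hS v h := by
    simp only [LowerSet.mem_sInf_iff] at h ⊢
    exact fun T hT => hA hT u S hS v fun s hs => h s hs T hT
  himp_mem' A T hT u S hS v h := by
    have key : ∀ w, w ∈ A ⇨ T ↔ ∀ w' ≤ w, w' ∈ A → w' ∈ T := by
      intro w
      rw [← LowerSet.Iic_le, le_himp_iff]
      exact ⟨fun h w' hw hA => h ⟨hw, hA⟩, fun h w' hw => h w' hw.1 hw.2⟩
    rw [key]
    intro w hw hA
    have h1 : u ⊓ w = w := inf_eq_right.2 (hw.trans inf_le_left)
    rw [← h1]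
    refine hT u S hS w fun s hs => (key _).1 (h s hs) _ ?_ (A.lower inf_le_right hA)
    exact inf_le_inf_left _ (hw.trans inf_le_right)

variable {cov : D → Set D → Prop}

/-- The associated sheaf `#u` of (the presheaf represented by) an object `u` of the site. -/
def sharp (cov : D → Set D → Prop) (u : D) : sheaves cov :=
  (sheaves cov).restrict (LowerSet.Iic u)

lemma sharp_le {u : D} {T : sheaves cov} : sharp cov u ≤ T ↔ u ∈ T.1 := by
  rw [← LowerSet.Iic_le]
  exact (sheaves cov).giRestrict.gc _ _

lemma sharp_inf (u v : D) : sharp cov (u ⊓ v) = sharp cov u ⊓ sharp cov v := by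
  rw [sharp, sharp, sharp, ← map_inf, LowerSet.Iic_inf]

lemma sharp_top [OrderTop D] : sharp cov ⊤ = ⊤ := by
  rw [sharp, LowerSet.Iic_top, map_top]

lemma sharp_cov {u : D} {S : Set D} (h : cov u S) : sharp cov u ≤ ⨆ s ∈ S, sharp cov s := by
  rw [sharp_le, ← inf_idem u]
  refine (⨆ s ∈ S, sharp cov s).2 u S h u fun s hs => LowerSet.lower _ inf_le_left ?_
  exact sharp_le.1 (le_iSup₂_of_le s hs le_rfl)

lemma eq_iSup_sharp (T : sheaves cov) : T = ⨆ u ∈ T.1, sharp cov u := by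
  refine le_antisymm (fun u hu => ?_) (iSup₂_le fun u hu => sharp_le.2 hu)
  exact sharp_le.1 (le_iSup₂_of_le (f := fun u (_ : u ∈ T.1) => sharp cov u) u hu le_rfl)

variable {H : Type v} [Order.Frame H]

lemma lift_gc (f : D → H) (hinf : ∀ a b, f (a ⊓ b) = f a ⊓ f b)
    (hcov : ∀ u S, cov u S → f u ≤ ⨆ s ∈ S, f s) (h : H) :
    ∃ R : sheaves cov, ∀ u, u ∈ R.1 ↔ f u ≤ h := by
  have mono : Monotone f := fun a b hab => by
    rw [← inf_eq_left.2 hab, hinf]; exact inf_le_right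
  refine ⟨⟨⟨{u | f u ≤ h}, fun a b hab hb => (mono hab).trans hb⟩, ?_⟩, fun u => Iff.rfl⟩
  intro u S hS v hv
  change f (u ⊓ v) ≤ h
  rw [hinf]
  refine (inf_le_inf_right _ (hcov u S hS)).trans ?_
  rw [iSup₂_inf_eq]
  refine iSup₂_le fun s hs => ?_
  rw [← hinf]
  exact hv s hs

/-- The morphism of locales out of `D^~` extending a point `f : D → H` of the site. -/
def liftSheaves [OrderTop D] (f : D → H) (hinf : ∀ a b, f (a ⊓ b) = f a ⊓ f b) (htop : f ⊤ = ⊤)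
    (hcov : ∀ u S, cov u S → f u ≤ ⨆ s ∈ S, f s) : FrameHom (sheaves cov) H where
  toFun T := ⨆ u ∈ T.1, f u
  map_inf' S T := by
    refine le_antisymm (le_inf ?_ ?_) ?_
    · exact iSup₂_le fun u hu => le_iSup₂_of_le u hu.1 le_rfl
    · exact iSup₂_le fun u hu => le_iSup₂_of_le u hu.2 le_rfl
    · rw [iSup₂_inf_eq]
      refine iSup₂_le fun a ha => ?_
      rw [inf_iSup₂_eq]
      refine iSup₂_le fun b hb => ?_
      rw [← hinf]
      exact le_iSup₂_of_le (f := fun u _ => f u) (a ⊓ b)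
        ⟨S.1.lower inf_le_left ha, T.1.lower inf_le_right hb⟩ le_rfl
  map_top' := top_unique (htop.ge.trans (le_iSup₂_of_le (f := fun u _ => f u) ⊤ trivial le_rfl))
  map_sSup' A := by
    refine le_antisymm ?_ ?_
    · obtain ⟨R, hR⟩ := lift_gc f hinf hcov (sSup ((fun T : sheaves cov => ⨆ u ∈ T.1, f u) '' A))
      have : sSup A ≤ R := sSup_le fun T hT u hu =>
        (hR u).2 ((le_iSup₂_of_le (f := fun u _ => f u) u hu le_rfl).trans
          (le_sSup ⟨T, hT, rfl⟩))
      exact iSup₂_le fun u hu => (hR u).1 (this hu)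
    · refine sSup_le ?_
      rintro _ ⟨T, hT, rfl⟩
      exact iSup₂_le fun u hu => le_iSup₂_of_le (f := fun u _ => f u) u (le_sSup hT hu) le_rfl

lemma liftSheaves_sharp [OrderTop D] (f : D → H) (hinf : ∀ a b, f (a ⊓ b) = f a ⊓ f b) (htop : f ⊤ = ⊤)
    (hcov : ∀ u S, cov u S → f u ≤ ⨆ s ∈ S, f s) (u : D) :
    liftSheaves f hinf htop hcov (sharp cov u) = f u := by
  refine le_antisymm ?_ (le_iSup₂_of_le (f := fun u _ => f u) u (sharp_le.1 le_rfl) le_rfl)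
  obtain ⟨R, hR⟩ := lift_gc (cov := cov) f hinf hcov (f u)
  have : sharp cov u ≤ R := sharp_le.2 ((hR u).2 le_rfl)
  exact iSup₂_le fun w hw => (hR w).1 (this hw)

lemma frameHom_ext_sharp {φ ψ : FrameHom (sheaves cov) H}
    (h : ∀ u, φ (sharp cov u) = ψ (sharp cov u)) : φ = ψ := by
  ext T
  rw [eq_iSup_sharp T]
  simp only [map_iSup, h]

end Site

/-! ### Products of locales -/

section Product

variable (A : Type w) (B : Type w) [Order.Frame A] [Order.Frame B]

/-- The basic covers on the inf-lattice `A × B` which present the coproduct of the frames. -/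
inductive TensorCov : A × B → Set (A × B) → Prop
  | left (S : Set A) (b : B) : TensorCov (sSup S, b) ((fun a => (a, b)) '' S)
  | right (a : A) (S : Set B) : TensorCov (a, sSup S) ((fun b => (a, b)) '' S)

/-- The underlying frame `A ⊗ B` of the product of two localic spaces; `sharp (a, b)` is
`a ⊗ b`. -/
abbrev Tensor : Type w := sheaves (TensorCov A B)

variable {A B}

def tensorInl : FrameHom A (Tensor A B) where
  toFun a := sharp _ (a, ⊤)
  map_inf' a b := by rw [← sharp_inf]; simp
  map_top' := sharp_top
  map_sSup' S := by
    refine le_antisymm ((sharp_cov (.left S ⊤)).trans ?_) (sSup_le ?_)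
    · refine iSup₂_le ?_
      rintro _ ⟨a, ha, rfl⟩
      exact le_sSup ⟨a, ha, rfl⟩
    · rintro _ ⟨a, ha, rfl⟩
      rw [sharp_le]
      exact LowerSet.lower _ (show (a, ⊤) ≤ (sSup S, (⊤ : B)) from ⟨le_sSup ha, le_rfl⟩)
        (sharp_le.1 le_rfl)

def tensorInr : FrameHom B (Tensor A B) where
  toFun b := sharp _ (⊤, b)
  map_inf' a b := by rw [← sharp_inf]; simp
  map_top' := sharp_top
  map_sSup' S := by
    refine le_antisymm ((sharp_cov (.right ⊤ S)).trans ?_) (sSup_le ?_)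
    · refine iSup₂_le ?_
      rintro _ ⟨a, ha, rfl⟩
      exact le_sSup ⟨a, ha, rfl⟩
    · rintro _ ⟨a, ha, rfl⟩
      rw [sharp_le]
      exact LowerSet.lower _ (show (⊤, a) ≤ ((⊤ : A), sSup S) from ⟨le_rfl, le_sSup ha⟩)
        (sharp_le.1 le_rfl)

lemma sharp_eq_inl_inf_inr (a : A) (b : B) :
    sharp (TensorCov A B) (a, b) = tensorInl a ⊓ tensorInr b := by
  change _ = sharp _ (a, ⊤) ⊓ sharp _ (⊤, b)
  rw [← sharp_inf]; simp

variable {H : Type w} [Order.Frame H]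

def tensorDesc (f : FrameHom A H) (g : FrameHom B H) : FrameHom (Tensor A B) H :=
  liftSheaves (fun p => f p.1 ⊓ g p.2)
    (fun p q => by simp only [Prod.fst_inf, Prod.snd_inf, map_inf]; exact inf_inf_inf_comm _ _ _ _)
    (by simp)
    (by
      rintro _ _ (⟨S, b⟩ | ⟨a, S⟩)
      · simp only [map_sSup, sSup_inf_eq, iSup_image]
        exact le_rfl
      · simp only [map_sSup, inf_sSup_eq, iSup_image]
        exact le_rfl)

lemma tensorDesc_inl (f : FrameHom A H) (g : FrameHom B H) (a : A) :
    tensorDesc f g (tensorInl a) = f a := by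
  refine (liftSheaves_sharp _ _ _ _ _).trans ?_
  simp

lemma tensorDesc_inr (f : FrameHom A H) (g : FrameHom B H) (b : B) :
    tensorDesc f g (tensorInr b) = g b := by
  refine (liftSheaves_sharp _ _ _ _ _).trans ?_
  simp

lemma tensor_hom_ext {φ ψ : FrameHom (Tensor A B) H}
    (h₁ : ∀ a, φ (tensorInl a) = ψ (tensorInl a))
    (h₂ : ∀ b, φ (tensorInr b) = ψ (tensorInr b)) : φ = ψ := by
  refine frameHom_ext_sharp fun p => ?_
  rw [← Prod.mk.eta (p := p), sharp_eq_inl_inf_inr, map_inf, map_inf, h₁, h₂]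

end Product

/-! ### The cartesian category of localic spaces -/

section LocaleCat

/-- The category of localic spaces: the formal dual of the category of locales (frames).
The locale corresponding to `G` is `G.unop`. -/
abbrev LocalicSpace := Frm.{w}ᵒᵖ

/-- The inverse image `f^*` of a continuous map `f` of localic spaces. -/
def invImage {G H : LocalicSpace.{w}} (f : G ⟶ H) : FrameHom H.unop G.unop :=
  Frm.Hom.hom (f.unop)

/-- The continuous map of localic spaces with a given inverse image. -/
def ofInvImage {G H : LocalicSpace.{w}} (φ : FrameHom H.unop G.unop) : G ⟶ H :=
  (Frm.ofHom φ).op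

@[simp] lemma invImage_ofInvImage {G H : LocalicSpace.{w}} (φ : FrameHom H.unop G.unop) :
    invImage (ofInvImage φ) = φ := rfl

@[simp] lemma ofInvImage_invImage {G H : LocalicSpace.{w}} (f : G ⟶ H) :
    ofInvImage (invImage f) = f := rfl

@[simp] lemma invImage_comp_apply {G H K : LocalicSpace.{w}} (f : G ⟶ H) (g : H ⟶ K) (k : K.unop) :
    invImage (f ≫ g) k = invImage f (invImage g k) := rfl

@[simp] lemma invImage_id_apply {G : LocalicSpace.{w}} (k : G.unop) : invImage (𝟙 G) k = k := rfl

lemma locale_hom_ext {G H : LocalicSpace.{w}} {f g : G ⟶ H} (h : invImage f = invImage g) : f = g := by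
  rw [← ofInvImage_invImage f, h, ofInvImage_invImage]

/-- The one-point localic space. -/
def pointLocale : LocalicSpace.{w} := op (Frm.of (Set PUnit.{w + 1}))

def toPointInv (G : Type w) [Order.Frame G] : FrameHom (Set PUnit.{w + 1}) G where
  toFun S := ⨆ _ : PUnit.unit ∈ S, ⊤
  map_inf' S T := by
    by_cases h : PUnit.unit ∈ S <;> by_cases h' : PUnit.unit ∈ T <;> simp [h, h']
  map_top' := by simp
  map_sSup' A := by
    refine le_antisymm (iSup_le fun ⟨S, hS, h⟩ => ?_) (sSup_le ?_)
    · exact le_sSup_of_le ⟨S, hS, rfl⟩ (le_iSup_of_le h le_rfl)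
    · rintro _ ⟨S, hS, rfl⟩
      exact iSup_le fun h => le_iSup_of_le (ι := PUnit.unit ∈ sSup A) ⟨S, hS, h⟩ le_rfl

lemma eq_toPointInv {G : Type w} [Order.Frame G] (φ : FrameHom (Set PUnit.{w + 1}) G) :
    φ = toPointInv G := by
  ext S
  change φ S = ⨆ _ : PUnit.unit ∈ S, ⊤
  by_cases h : PUnit.unit ∈ S
  · rw [show S = ⊤ from Set.eq_univ_of_forall fun _ => h, map_top]; simp
  · rw [show S = ⊥ from Set.eq_empty_of_forall_notMem fun _ => h, map_bot]; simp

def isTerminalPoint : IsTerminal pointLocale.{w} :=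
  IsTerminal.ofUniqueHom (fun G => ofInvImage (toPointInv G.unop)) fun _ _ =>
    locale_hom_ext (eq_toPointInv _)

/-- The product of two localic spaces. -/
def prodLocale (G H : LocalicSpace.{w}) : LocalicSpace.{w} := op (Frm.of (Tensor G.unop H.unop))

def prodFst (G H : LocalicSpace.{w}) : prodLocale G H ⟶ G := ofInvImage (tensorInl (A := G.unop) (B := H.unop))

def prodSnd (G H : LocalicSpace.{w}) : prodLocale G H ⟶ H := ofInvImage (tensorInr (A := G.unop) (B := H.unop))

def prodLift {G H K : LocalicSpace.{w}} (f : K ⟶ G) (g : K ⟶ H) : K ⟶ prodLocale G H :=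
  ofInvImage (tensorDesc (invImage f) (invImage g))

def isLimitProd (G H : LocalicSpace.{w}) : IsLimit (BinaryFan.mk (prodFst G H) (prodSnd G H)) :=
  BinaryFan.isLimitMk (fun s => prodLift s.fst s.snd)
    (fun _ => locale_hom_ext (FrameHom.ext fun _ => tensorDesc_inl _ _ _))
    (fun _ => locale_hom_ext (FrameHom.ext fun _ => tensorDesc_inr _ _ _))
    (fun _ _ h₁ h₂ => locale_hom_ext (tensor_hom_ext
      (fun a => (congrArg (fun f => invImage f a) h₁).trans (tensorDesc_inl _ _ _).symm)
      (fun b => (congrArg (fun f => invImage f b) h₂).trans (tensorDesc_inr _ _ _).symm)))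

instance : CartesianMonoidalCategory LocalicSpace.{w} :=
  CartesianMonoidalCategory.ofChosenFiniteProducts ⟨asEmptyCone pointLocale, isTerminalPoint⟩
    fun G H => ⟨BinaryFan.mk (prodFst G H) (prodSnd G H), isLimitProd G H⟩

end LocaleCat

/-! ### The free inf-lattice on a poset -/

section FreeInf

variable (P : Type w) [Preorder P]

/-- The free inf-lattice `𝒟(P)` on a poset `P`: the finitely generated upward closed subsets of
`P`, ordered by reverse inclusion (this is the order of `UpperSet P`). -/
def FreeInf : Type w := {U : UpperSet P // ∃ s : Set P, s.Finite ∧ upperClosure s = U}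

namespace FreeInf

instance : SemilatticeInf (FreeInf P) :=
  Subtype.semilatticeInf fun {_ _} ⟨s, hs, h⟩ ⟨t, ht, h'⟩ =>
    ⟨s ∪ t, hs.union ht, by rw [upperClosure_union, h, h']⟩

instance : OrderTop (FreeInf P) :=
  Subtype.orderTop ⟨∅, Set.finite_empty, upperClosure_empty⟩

variable {P}

/-- The generator `[p]` of `𝒟(P)`. -/
def gen (p : P) : FreeInf P :=
  ⟨upperClosure {p}, {p}, Set.finite_singleton p, rfl⟩

lemma gen_mono {p q : P} (h : p ≤ q) : gen p ≤ gen q := by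
  change upperClosure {p} ≤ upperClosure {q}
  simpa using h

lemma induction {motive : FreeInf P → Prop} (top : motive ⊤)
    (inf : ∀ p U, motive U → motive (gen p ⊓ U)) (U : FreeInf P) : motive U := by
  obtain ⟨U, s, hs, rfl⟩ := U
  induction s, hs using Set.Finite.induction_on with
  | empty =>
    have e : (⟨upperClosure ∅, ∅, Set.finite_empty, rfl⟩ : FreeInf P) = (⊤ : FreeInf P) :=
      Subtype.ext upperClosure_empty
    exact e ▸ top
  | @insert p t _ ht ih =>
    have e : (⟨upperClosure (insert p t), insert p t, ht.insert p, rfl⟩ : FreeInf P) =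
        gen p ⊓ ⟨upperClosure t, t, ht, rfl⟩ := by
      apply Subtype.ext
      change upperClosure (insert p t) = upperClosure {p} ⊓ upperClosure t
      rw [Set.insert_eq, upperClosure_union]
    exact e ▸ inf p _ ih

/-- The inf-preserving extension of an order preserving map `P → H`. -/
def ext {H : Type v} [CompleteLattice H] (φ : P → H) (U : FreeInf P) : H := ⨅ p ∈ U.1, φ p

lemma ext_inf {H : Type v} [CompleteLattice H] (φ : P → H) (U V : FreeInf P) :
    ext φ (U ⊓ V) = ext φ U ⊓ ext φ V := by
  change (⨅ p ∈ U.1 ⊓ V.1, φ p) = _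
  simp only [UpperSet.mem_inf_iff, iInf_or, iInf_inf_eq]
  rfl

lemma ext_top {H : Type v} [CompleteLattice H] (φ : P → H) : ext φ ⊤ = ⊤ := by
  change (⨅ p ∈ (⊤ : UpperSet P), φ p) = ⊤
  simp

lemma ext_gen {H : Type v} [CompleteLattice H] {φ : P → H} (hφ : Monotone φ) (p : P) :
    ext φ (gen p) = φ p := by
  change (⨅ q ∈ upperClosure {p}, φ q) = φ p
  refine le_antisymm (iInf₂_le p (by simp)) (le_iInf₂ fun q hq => hφ ?_)
  simpa using hq

end FreeInf

end FreeInf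

/-! ### The localic group of automorphisms of a set-valued functor -/

section LAut

variable {C : Type u} [Category.{v₁} C] (F : C ⥤ Type v)

/-- The poset `D_{ΔF}`: its elements `⟨X, (x₀, x₁)⟩`, with `x₀, x₁ ∈ FX`, are ordered by
`⟨X, (x₀, x₁)⟩ ≤ ⟨Y, (y₀, y₁)⟩` if and only if there is `f : X ⟶ Y` with `F(f)(x₀) = y₀` and
`F(f)(x₁) = y₁`. -/
def RelPoset : Type (max u v) := Σ X : C, F.obj X × F.obj X

instance : Preorder (RelPoset F) where
  le p q := ∃ f : p.1 ⟶ q.1, F.map f p.2.1 = q.2.1 ∧ F.map f p.2.2 = q.2.2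
  le_refl p := ⟨𝟙 _, by simp, by simp⟩
  le_trans p q r := by
    rintro ⟨f, h₁, h₂⟩ ⟨g, h₃, h₄⟩
    exact ⟨f ≫ g, by simp [h₁, h₃], by simp [h₂, h₄]⟩

variable {F} in
/-- The object `[(X, <x | y>)]` of the site `𝒟(D_{ΔF})`. -/
def relGen (X : C) (x y : F.obj X) : FreeInf (RelPoset F) :=
  FreeInf.gen (⟨X, (x, y)⟩ : RelPoset F)

/-- The basic covers which force a natural relation on `F` to be, in turn, univalued, injective,
everywhere defined and surjective. -/
inductive AutCov : FreeInf (RelPoset F) → Set (FreeInf (RelPoset F)) → Prop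
  | univalued (X : C) (x y z : F.obj X) (h : x ≠ y) : AutCov (relGen X z x ⊓ relGen X z y) ∅
  | injective (X : C) (x y z : F.obj X) (h : x ≠ y) : AutCov (relGen X x z ⊓ relGen X y z) ∅
  | total (X : C) (z : F.obj X) : AutCov ⊤ (Set.range fun x => relGen X z x)
  | surjective (X : C) (z : F.obj X) : AutCov ⊤ (Set.range fun x => relGen X x z)

/-- The locale `lAut(F)` of automorphisms of `F`: the locale of sheaves on the site
`𝒟(D_{ΔF})`. -/
abbrev LAutFrame : Type (max u v) := sheaves (AutCov F)

/-- The localic space `lAut(F)`. -/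
def lAut : LocalicSpace.{max u v} := op (Frm.of (LAutFrame F))

variable {F} in
/-- The element `#[(X, <x | y>)]` of the locale `lAut(F)`. -/
def lAutGen (X : C) (x y : F.obj X) : LAutFrame F := sharp (AutCov F) (relGen X x y)

/-- An `H`-valued automorphism of `F`, for `H` a locale: an `H`-valued natural relation on `F`
which is univalued, injective, everywhere defined and surjective. -/
@[ext]
structure ValuedAut (H : Type w) [Order.Frame H] where
  val : ∀ X : C, F.obj X → F.obj X → H
  natural : ∀ {X Y : C} (f : X ⟶ Y) (x y : F.obj X),
    val X x y ≤ val Y (F.map f x) (F.map f y)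
  univalued : ∀ (X : C) (x y z : F.obj X), x ≠ y → val X z x ⊓ val X z y = ⊥
  injective : ∀ (X : C) (x y z : F.obj X), x ≠ y → val X x z ⊓ val X y z = ⊥
  total : ∀ (X : C) (z : F.obj X), ⨆ x, val X z x = ⊤
  surjective : ∀ (X : C) (z : F.obj X), ⨆ x, val X x z = ⊤

namespace ValuedAut

variable {F} {H : Type w} [Order.Frame H]

open Classical in
noncomputable instance : One (ValuedAut F H) where
  one :=
    { val := fun _ x y => if x = y then ⊤ else ⊥
      natural := fun f x y => by by_cases h : x = y <;> simp [h]
      univalued := fun X x y z h => by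
        by_cases h₁ : z = x
        · subst h₁; simp [h]
        · simp [h₁]
      injective := fun X x y z h => by
        by_cases h₁ : x = z
        · subst h₁; simp [h.symm]
        · simp [h₁]
      total := fun X z => top_unique (le_iSup_of_le z (by simp))
      surjective := fun X z => top_unique (le_iSup_of_le z (by simp)) }

instance : Inv (ValuedAut F H) where
  inv a :=
    { val := fun X x y => a.val X y x
      natural := fun f x y => a.natural f y x
      univalued := a.injective
      injective := a.univalued
      total := a.surjective
      surjective := a.total }

instance : Mul (ValuedAut F H) where
  mul a b :=
    { val := fun X x y => ⨆ z, a.val X x z ⊓ b.val X z y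
      natural := fun f x y => iSup_le fun z =>
        le_iSup_of_le (F.map f z) (inf_le_inf (a.natural f x z) (b.natural f z y))
      univalued := fun X x y z h => by
        rw [iSup_inf_iSup]
        refine bot_unique (iSup_le fun p => ?_)
        rw [inf_inf_inf_comm]
        by_cases hp : p.1 = p.2
        · rw [hp, b.univalued X x y _ h, inf_bot_eq]
        · rw [a.univalued X _ _ _ hp, bot_inf_eq]
      injective := fun X x y z h => by
        rw [iSup_inf_iSup]
        refine bot_unique (iSup_le fun p => ?_)
        rw [inf_inf_inf_comm]
        by_cases hp : p.1 = p.2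
        · rw [hp, a.injective X x y _ h, bot_inf_eq]
        · rw [b.injective X _ _ _ hp, inf_bot_eq]
      total := fun X z => by
        rw [iSup_comm]
        simp only [← inf_iSup_eq, b.total, inf_top_eq, a.total]
      surjective := fun X z => by
        rw [iSup_comm]
        simp only [← iSup_inf_eq, a.surjective, top_inf_eq, b.surjective] }

open Classical in
lemma one_val (X : C) (x y : F.obj X) :
    (1 : ValuedAut F H).val X x y = if x = y then ⊤ else ⊥ := rfl

lemma mul_val (a b : ValuedAut F H) (X : C) (x y : F.obj X) :
    (a * b).val X x y = ⨆ z, a.val X x z ⊓ b.val X z y := rfl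

lemma inv_val (a : ValuedAut F H) (X : C) (x y : F.obj X) :
    a⁻¹.val X x y = a.val X y x := rfl

/-- The `H`-valued automorphisms of `F` form a group under composition of relations. -/
noncomputable instance : Group (ValuedAut F H) :=
  Group.ofLeftAxioms
    (fun a b c => by
      ext X x y
      simp only [mul_val, iSup_inf_eq, inf_iSup_eq]
      rw [iSup_comm]
      simp only [inf_assoc])
    (fun a => by
      ext X x y
      rw [mul_val]
      refine le_antisymm (iSup_le fun z => ?_) (le_iSup_of_le x (by simp [one_val]))
      by_cases h : x = z
      · subst h; exact inf_le_right
      · simp [one_val, h])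
    (fun a => by
      ext X x y
      rw [mul_val, one_val]
      split_ifs with h
      · subst h
        simp only [inv_val, inf_idem, a.surjective]
      · refine bot_unique (iSup_le fun z => ?_)
        rw [inv_val, a.univalued X x y z h])

/-- The image of an `H`-valued automorphism under a morphism of locales. -/
def map {K : Type w'} [Order.Frame K] (φ : FrameHom H K) (a : ValuedAut F H) : ValuedAut F K where
  val X x y := φ (a.val X x y)
  natural f x y := OrderHomClass.mono φ (a.natural f x y)
  univalued X x y z h := by rw [← map_inf, a.univalued X x y z h, map_bot]
  injective X x y z h := by rw [← map_inf, a.injective X x y z h, map_bot]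
  total X z := by rw [← map_iSup, a.total, map_top]
  surjective X z := by rw [← map_iSup, a.surjective, map_top]

lemma map_mul {K : Type w'} [Order.Frame K] (φ : FrameHom H K) (a b : ValuedAut F H) :
    (a * b).map φ = a.map φ * b.map φ := by
  ext X x y
  change φ (⨆ z, a.val X x z ⊓ b.val X z y) = ⨆ z, φ (a.val X x z) ⊓ φ (b.val X z y)
  simp only [map_iSup, map_inf]

end ValuedAut

/-- The generic automorphism of `F`, with values in `lAut(F)`. -/
def genericAut : ValuedAut F (LAutFrame F) where
  val X x y := lAutGen X x y
  natural {X Y} f x y := by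
    refine sharp_le.2 (LowerSet.lower _ ?_ (sharp_le.1 le_rfl))
    exact FreeInf.gen_mono ⟨f, rfl, rfl⟩
  univalued X x y z h := by
    refine bot_unique ?_
    have := sharp_cov (AutCov.univalued X x y z h)
    simpa [sharp_inf, lAutGen] using this
  injective X x y z h := by
    refine bot_unique ?_
    have := sharp_cov (AutCov.injective X x y z h)
    simpa [sharp_inf, lAutGen] using this
  total X z := top_unique (by
    have := sharp_cov (AutCov.total X z)
    rwa [sharp_top, iSup_range] at this)
  surjective X z := top_unique (by
    have := sharp_cov (AutCov.surjective X z)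
    rwa [sharp_top, iSup_range] at this)

variable {F} in
lemma ValuedAut.monotone_val {H : Type w} [Order.Frame H] (a : ValuedAut F H) :
    Monotone fun p : RelPoset F => a.val p.1 p.2.1 p.2.2 := by
  rintro ⟨X, x, y⟩ ⟨Y, x', y'⟩ ⟨f, h₁, h₂⟩
  change a.val X x y ≤ a.val Y x' y'
  rw [← show _ = x' from h₁, ← show _ = y' from h₂]
  exact a.natural f x y

variable {F} in
/-- The inf-preserving map `𝒟(D_{ΔF}) → H` determined by an `H`-valued automorphism of `F`. -/
def ValuedAut.point {H : Type w} [Order.Frame H] (a : ValuedAut F H) :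
    FreeInf (RelPoset F) → H :=
  FreeInf.ext fun p : RelPoset F => a.val p.1 p.2.1 p.2.2

variable {F} in
lemma ValuedAut.point_relGen {H : Type w} [Order.Frame H] (a : ValuedAut F H) (X : C)
    (x y : F.obj X) : a.point (relGen X x y) = a.val X x y :=
  FreeInf.ext_gen a.monotone_val _

variable {F} in
lemma ValuedAut.point_cov {H : Type w} [Order.Frame H] (a : ValuedAut F H)
    (U : FreeInf (RelPoset F)) (S : Set (FreeInf (RelPoset F))) (h : AutCov F U S) :
    a.point U ≤ ⨆ s ∈ S, a.point s := by
  have hinf : ∀ U V, a.point (U ⊓ V) = a.point U ⊓ a.point V := FreeInf.ext_inf _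
  obtain ⟨X, x, y, z, h⟩ | ⟨X, x, y, z, h⟩ | ⟨X, z⟩ | ⟨X, z⟩ := h
  · simp [hinf, point_relGen, a.univalued X x y z h]
  · simp [hinf, point_relGen, a.injective X x y z h]
  · rw [iSup_range]; simp only [point_relGen, a.total, le_top]
  · rw [iSup_range]; simp only [point_relGen, a.surjective, le_top]

variable {F} in
/-- The morphism of locales `lAut(F) → H` classifying an `H`-valued automorphism of `F`. -/
def classify {H : Type w} [Order.Frame H] (a : ValuedAut F H) : FrameHom (LAutFrame F) H :=
  liftSheaves a.point (FreeInf.ext_inf _) (FreeInf.ext_top _) a.point_cov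

variable {F} in
lemma classify_lAutGen {H : Type w} [Order.Frame H] (a : ValuedAut F H) (X : C) (x y : F.obj X) :
    classify a (lAutGen X x y) = a.val X x y :=
  (liftSheaves_sharp _ _ _ _ _).trans (a.point_relGen X x y)

variable {F} in
lemma lAut_hom_ext {H : Type w} [Order.Frame H] {φ ψ : FrameHom (LAutFrame F) H}
    (h : ∀ X x y, φ (lAutGen X x y) = ψ (lAutGen X x y)) : φ = ψ := by
  refine frameHom_ext_sharp fun U => ?_
  induction U using FreeInf.induction with
  | top => rw [sharp_top, map_top, map_top]
  | inf p U ih =>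
    rw [sharp_inf, map_inf, map_inf, ih]
    congr 1
    exact h p.1 p.2.1 p.2.2

/-- Frame morphisms out of `lAut(F)` are the same as automorphisms of `F` valued in a frame. -/
def lAutEquiv (H : Type w) [Order.Frame H] : FrameHom (LAutFrame F) H ≃ ValuedAut F H where
  toFun φ := (genericAut F).map φ
  invFun := classify
  left_inv _ := lAut_hom_ext fun X x y => classify_lAutGen _ X x y
  right_inv a := ValuedAut.ext (funext fun X => funext fun x => funext fun y =>
    classify_lAutGen a X x y)

/-- The presheaf of groups on localic spaces which sends `H` to the group of `H`-valued
automorphisms of `F`. -/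
noncomputable def valuedAutFunctor : LocalicSpace.{max u v}ᵒᵖ ⥤ GrpCat.{max u v} where
  obj H := GrpCat.of (ValuedAut F H.unop.unop)
  map f := GrpCat.ofHom (MonoidHom.mk' (ValuedAut.map (invImage f.unop))
    (ValuedAut.map_mul (invImage f.unop)))

/-- The localic space `lAut(F)` represents `valuedAutFunctor F`. -/
noncomputable def lAutRepresentable : (valuedAutFunctor F ⋙ forget GrpCat).RepresentableBy (lAut F) where
  homEquiv {H} :=
    { toFun := fun f => (genericAut F).map (invImage f)
      invFun := fun a => ofInvImage (classify a)
      left_inv := fun f => locale_hom_ext ((lAutEquiv F H.unop).left_inv (invImage f))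
      right_inv := fun a => (lAutEquiv F H.unop).right_inv a }
  homEquiv_comp _ _ := rfl

/-- The group structure of the localic space `lAut(F)`. Its multiplication is characterized by
`m^*[(X, <x | y>)] = ⋁_z [(X, <x | z>)] ⊗ [(X, <z | y>)]`, its neutral element by
`e^*[(X, <x | y>)] = 1` if `x = y`, and `0` otherwise. -/
noncomputable instance : GrpObj (lAut F) :=
  GrpObj.ofRepresentableBy (lAut F) (valuedAutFunctor F) (lAutRepresentable F)

end LAut

/-! ### Actions of localic groups on sets and the classifying topos -/

section GSets

open MonoidalCategory CartesianMonoidalCategory MonObj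

/-- The localic group `lAut(X)` of automorphisms of a set `X`, that is, of the functor on the
one-arrow category with value `X`: here `D_{ΔF}` is the set `X × X` with the discrete order. The
universe parameter `u` only serves to place `lAut(X)` in a universe large enough. -/
abbrev lAutSet (X : Type v) : LocalicSpace.{max u v} :=
  lAut (Functor.fromPUnit.{u} X)

/-- The generator `[<x | y>]` of the locale `lAut(X)`. -/
def setGen {X : Type v} (x y : X) : (lAutSet.{v, u} X).unop :=
  lAutGen (F := Functor.fromPUnit.{u} X) ⟨PUnit.unit⟩ x y

set_option linter.checkUnivs false in
/-- A `G`-set: a set `X` with an action of the localic group `G`, that is, a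
morphism of localic groups `G ⟶ lAut(X)`. -/
structure GSet (G : LocalicSpace.{max u v}) [GrpObj G] where
  carrier : Type v
  action : G ⟶ lAutSet.{v, u} carrier
  [isMonHom_action : IsMonHom action]

namespace GSet

variable {G : LocalicSpace.{max u v}} [GrpObj G]

/-- The element `μ^*[<x | y>]` of `G`, described informally as `{g | g x = y}`. -/
def act (S : GSet.{v, u} G) (x y : S.carrier) : G.unop :=
  invImage S.action (setGen x y)

/-- A morphism of `G`-sets. -/
@[ext]
structure Hom (S T : GSet.{v, u} G) where
  toFun : S.carrier → T.carrier
  act_le : ∀ x y, S.act x y ≤ T.act (toFun x) (toFun y)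

/-- The category `ℬG` of `G`-sets. -/
instance : Category.{v} (GSet.{v, u} G) where
  Hom := Hom
  id S := ⟨id, fun _ _ => le_rfl⟩
  comp f g := ⟨g.toFun ∘ f.toFun, fun x y => (f.act_le x y).trans (g.act_le _ _)⟩

/-- The action is transitive if no `μ^*[<x | y>]` is `0`. -/
def IsTransitive (S : GSet.{v, u} G) : Prop := ∀ x y, S.act x y ≠ ⊥

variable (G) in
/-- The objects of the full subcategory `tℬG` of nonempty transitive `G`-sets. -/
def nonemptyTransitive : ObjectProperty (GSet.{v, u} G) :=
  fun S => Nonempty S.carrier ∧ S.IsTransitive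

end GSet

variable {C : Type u} [Category.{v₁} C] (F : C ⥤ Type v)

variable {F} in
/-- The component at `X` of an `H`-valued automorphism of `F`. -/
def ValuedAut.component {H : Type w} [Order.Frame H] (a : ValuedAut F H) (X : C) :
    ValuedAut (Functor.fromPUnit.{u} (F.obj X)) H where
  val _ x y := a.val X x y
  natural _ _ _ := le_rfl
  univalued _ := a.univalued X
  injective _ := a.injective X
  total _ := a.total X
  surjective _ := a.surjective X

variable {F} in
/-- The `H`-valued automorphism of `F` classified by a continuous map `H ⟶ lAut(F)`. -/
def autOfHom {H : LocalicSpace.{max u v}} (f : H ⟶ lAut F) : ValuedAut F H.unop :=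
  (genericAut F).map (invImage f)

variable {F} in
lemma autOfHom_injective {H : LocalicSpace.{max u v}} {f g : H ⟶ lAut F}
    (h : autOfHom f = autOfHom g) : f = g :=
  (lAutRepresentable F).homEquiv.injective h

variable {F} in
lemma autOfHom_comp {H K : LocalicSpace.{max u v}} (f : H ⟶ K) (g : K ⟶ lAut F) :
    autOfHom (f ≫ g) = (autOfHom g).map (invImage f) := rfl

lemma autOfHom_one : autOfHom (η[lAut F]) = 1 :=
  (lAutRepresentable F).homEquiv.apply_symm_apply _

lemma autOfHom_mul :
    autOfHom (μ[lAut F]) = autOfHom (fst (lAut F) (lAut F)) * autOfHom (snd (lAut F) (lAut F)) :=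
  (lAutRepresentable F).homEquiv.apply_symm_apply _

lemma invImage_mul (X : C) (x y : F.obj X) :
    invImage (μ[lAut F]) (lAutGen X x y) =
      ⨆ z, sharp (TensorCov (LAutFrame F) (LAutFrame F)) (lAutGen X x z, lAutGen X z y) := by
  simp only [sharp_eq_inl_inf_inr]
  exact congrArg (fun a => a.val X x y) (autOfHom_mul F)

/-- The morphism of localic groups `lAut(F) ⟶ lAut(FX)` with inverse image
`[<x₀ | x₁>] ↦ #[(X, <x₀ | x₁>)]`. -/
def evalAut (X : C) : lAut F ⟶ lAutSet.{v, u} (F.obj X) :=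
  ofInvImage (classify ((genericAut F).component X))

lemma autOfHom_comp_evalAut {H : LocalicSpace.{max u v}} (f : H ⟶ lAut F) (X : C) :
    autOfHom (f ≫ evalAut F X) = (autOfHom f).component X :=
  ValuedAut.ext (funext fun Y => funext fun x => funext fun y =>
    congrArg (invImage f) (classify_lAutGen ((genericAut F).component X) Y x y))

lemma component_map {H : Type w} [Order.Frame H] {K : Type w'} [Order.Frame K]
    (φ : FrameHom H K) (a : ValuedAut F H) (X : C) :
    (a.map φ).component X = (a.component X).map φ := rfl

instance (X : C) : IsMonHom (evalAut F X) where
  one_hom := autOfHom_injective (by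
    rw [autOfHom_comp_evalAut, autOfHom_one, autOfHom_one]
    rfl)
  mul_hom := autOfHom_injective (by
    rw [autOfHom_comp_evalAut, autOfHom_mul, autOfHom_comp, autOfHom_mul, ValuedAut.map_mul,
      ← autOfHom_comp, ← autOfHom_comp, tensorHom_fst, tensorHom_snd, autOfHom_comp_evalAut,
      autOfHom_comp_evalAut]
    rfl)

lemma invImage_evalAut (X : C) (x y : F.obj X) :
    invImage (evalAut F X) (setGen x y) = lAutGen X x y :=
  classify_lAutGen ((genericAut F).component X) _ x y

/-- The lift `μF : C ⥤ ℬG`, for `G = lAut(F)`, of a set-valued functor `F`. -/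
def muF : C ⥤ GSet.{v, u} (lAut F) where
  obj X := { carrier := F.obj X, action := evalAut F X }
  map {X Y} f := ⟨fun x => F.map f x, fun x y => by
    change invImage (evalAut F X) (setGen x y) ≤
      invImage (evalAut F Y) (setGen (F.map f x) (F.map f y))
    rw [invImage_evalAut, invImage_evalAut]
    exact (genericAut F).natural f x y⟩
  map_id X := GSet.Hom.ext (funext fun x => by simp; rfl)
  map_comp f g := GSet.Hom.ext (funext fun x => by simp; rfl)

end GSets

/-! ### Prorepresentable functors, and sheaf topoi -/

section Topos

variable {C : Type u} [Category.{v} C]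

/-- `F` is prorepresentable: `F = [P, -] = colim_i [P_i, -]` for a pro-object `P = (P_i)` of `C`
indexed by a small cofiltered category. -/
def IsProrepresentable (F : C ⥤ Type v) : Prop :=
  ∃ (I : Type v) (_ : SmallCategory I) (_ : IsCofiltered I) (P : I ⥤ C),
    Nonempty (colimit (P.op ⋙ coyoneda) ≅ F)

/-- The functor `L : C ⥤ E` induces an equivalence between the category of
sheaves of sets on `C` for the topology `J` and `E`: there is an equivalence `e` whose inverse is
`S ↦ Hom_E(L(-), S)`, and which sends the presheaf represented by `X` to `L(X)`. -/
def InducesEquivalence (J : GrothendieckTopology C) {E : Type w} [Category.{v} E]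
    (L : C ⥤ E) : Prop :=
  ∃ e : Sheaf J (Type v) ≌ E,
    Nonempty (e.inverse ⋙ sheafToPresheaf J (Type v) ≅
      yoneda ⋙ (Functor.whiskeringLeft Cᵒᵖ Eᵒᵖ (Type v)).obj L.op) ∧
    Nonempty (L ⋙ e.inverse ⋙ sheafToPresheaf J (Type v) ≅ yoneda)

end Topos

end LocalicGalois

universe v u

open CategoryTheory LocalicGalois

namespace LocalicGalois

open Limits Opposite

/-! ### Categories of strict epimorphisms with a prorepresentable fibre functor -/

section Fiber

variable {C : Type u} [Category.{v} C]

/-! Prorepresentability, together with the fact that all arrows are epimorphisms, makes the category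
of elements of `F` a codirected preorder: two elements of fibres come from a common one, and an
arrow is determined by its value at a single element. So `C` behaves like a category of nonempty
transitive sets of a group, with `F` the underlying set functor, and the atomic topology is defined.

The frame of `lAut F` is given by generators and relations, and the crux is that it does not
collapse. Its universal property reduces this to exhibiting one automorphism of `F` with values in a
frame that is understood: `relAut`, valued in the closed lower sets of `D_{ΔF}`. There the empty set
is closed because `F` sends arrows to surjections, and principal lower sets are closed because
arrows are strict epimorphisms. Hence the generators are nonzero (`lAutGen_ne_bot`), which is
transitivity, and inequalities between them come from arrows (`exists_hom_of_lAutGen_le`), which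
makes `muF F` full.

Conversely, in a `G`-set `S` the stabilizer of `s` is an open neighbourhood of the unit, so it
contains the stabilizer of some `z` in some `FZ`, and a coset argument carried out in `G × G` gives
a morphism `FZ ⟶ S` with `z ↦ s` (`exists_hom_of_lAutGen_le_rel`). Thus every `G`-set is covered by
fibres, and `S ↦ Hom(μF(-), S)` is fully faithful into atomic sheaves. A sheaf `P` is recovered from
its stalk, the colimit of `P` over the elements of `F`, on which `G` acts (`germIso`); smallness of
`C` keeps the stalk in `Type v`. This proves (b). Part (a) follows because the atomic and canonical
topologies differ only when `C` is trivial (`atomic_eq_canonicalTopology`). -/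

/-- The elementary consequences of the Galois axioms: the category of elements of `F` is a
codirected preorder, all arrows of `C` are strict epimorphisms, `F` sends them to surjections,
and `F` has nonempty values. -/
structure IsGaloisFiber (F : C ⥤ Type v) : Prop where
  inhabited : Nonempty C
  directed : ∀ {X Y : C} (x : F.obj X) (y : F.obj Y),
    ∃ (Z : C) (z : F.obj Z) (f : Z ⟶ X) (g : Z ⟶ Y), F.map f z = x ∧ F.map g z = y
  unique : ∀ {X Y : C} {f g : X ⟶ Y} (x : F.obj X), F.map f x = F.map g x → f = g
  surj : ∀ {X Y : C} (f : X ⟶ Y), Function.Surjective (F.map f)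
  nonempty : ∀ X : C, Nonempty (F.obj X)
  strict : ∀ {X Y : C} (f : X ⟶ Y), EffectiveEpi f

/-- A prorepresentable functor is generated by compatible elements of the objects of the
representing pro-object. -/
lemma IsProrepresentable.exists_generators {F : C ⥤ Type v} (hF : IsProrepresentable F) :
    ∃ (I : Type v) (_ : SmallCategory I) (_ : IsCofiltered I) (P : I ⥤ C)
      (ξ : ∀ i, F.obj (P.obj i)), (∀ {i j : I} (φ : i ⟶ j), F.map (P.map φ) (ξ i) = ξ j) ∧
      (∀ {X : C} (x : F.obj X), ∃ (i : I) (a : P.obj i ⟶ X), F.map a (ξ i) = x) ∧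
      ∀ {X : C} {i : I} (a b : P.obj i ⟶ X), F.map a (ξ i) = F.map b (ξ i) →
        ∃ (k : I) (φ : k ⟶ i), P.map φ ≫ a = P.map φ ≫ b := by
  obtain ⟨I, _, _, P, ⟨e⟩⟩ := hF
  let K : Iᵒᵖ ⥤ C ⥤ Type v := P.op ⋙ coyoneda
  let ι (i : Iᵒᵖ) : K.obj i ⟶ F := colimit.ι K i ≫ e.hom
  have hι {i j : Iᵒᵖ} (φ : i ⟶ j) : K.map φ ≫ ι j = ι i := by
    simp only [ι, ← Category.assoc, colimit.w]
  let c (X : C) : Cocone (K ⋙ (evaluation C (Type v)).obj X) :=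
    ((evaluation C (Type v)).obj X).mapCocone (colimit.cocone K)
  have hc (X : C) : IsColimit (c X) :=
    isColimitOfPreserves ((evaluation C (Type v)).obj X) (colimit.isColimit K)
  -- The Yoneda element of the coprojection `[P_i, -] ⟶ F`; the coprojection is then `a ↦ F(a)(ξ
  -- i)`.
  let ξ (i : I) : F.obj (P.obj i) := (ι (op i)).app (P.obj i) (𝟙 (P.obj i))
  have hξ {i : I} {X : C} (a : P.obj i ⟶ X) : F.map a (ξ i) = (ι (op i)).app X a := by
    have := ConcreteCategory.congr_hom ((ι (op i)).naturality a) (𝟙 (P.obj i))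
    exact this.symm.trans (congrArg ((ι (op i)).app X) (Category.id_comp a))
  refine ⟨I, inferInstance, inferInstance, P, ξ, fun {i j} φ => ?_, fun {X} x => ?_,
    fun {X i} a b h => ?_⟩
  · rw [hξ]
    have := ConcreteCategory.congr_hom (NatTrans.congr_app (hι φ.op) (P.obj j)) (𝟙 (P.obj j))
    exact (congrArg ((ι (op i)).app (P.obj j)) (Category.comp_id (P.map φ)).symm).trans this
  · obtain ⟨i, a, ha⟩ := Types.jointly_surjective_of_isColimit (hc X) (e.inv.app X x)
    refine ⟨i.unop, a, ?_⟩
    rw [hξ]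
    change e.hom.app X ((c X).ι.app i a) = x
    rw [ha]
    exact ConcreteCategory.congr_hom (NatTrans.congr_app e.inv_hom_id X) x
  · rw [hξ, hξ] at h
    have h' : (c X).ι.app (op i) a = (c X).ι.app (op i) b := by
      have := congrArg (e.inv.app X) h
      have key (a : P.obj i ⟶ X) : e.inv.app X ((ι (op i)).app X a) = (c X).ι.app (op i) a :=
        ConcreteCategory.congr_hom (NatTrans.congr_app e.hom_inv_id X) ((c X).ι.app (op i) a)
      rwa [key, key] at this
    obtain ⟨k, φ, hk⟩ := (Types.FilteredColimit.isColimit_eq_iff' (hc X) a b).1 h'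
    exact ⟨k.unop, φ.unop, hk⟩

/-- Cofilteredness of the index category gives `directed`. For `unique`, arrows that agree at one
element become equal after precomposition with an arrow from some `P_k`, which is an epimorphism and
cancels. For `surj`, epimorphisms in `Type v` are surjections. -/
lemma IsGaloisFiber.of_isProrepresentable {F : C ⥤ Type v} (hF : IsProrepresentable F)
    (hC : ∀ {Y X : C} (f : Y ⟶ X), EffectiveEpi f) (hne : ∀ X : C, Nonempty (F.obj X))
    (hepi : F.PreservesEffectiveEpis) : IsGaloisFiber F := by
  obtain ⟨I, _, _, P, ξ, hξ, hsurj, hinj⟩ := hF.exists_generators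
  refine ⟨(IsCofiltered.nonempty (C := I)).map P.obj, fun {X Y} x y => ?_,
    fun {X Y f g} x h => ?_, fun f => ?_, hne, hC⟩
  · obtain ⟨i, a, rfl⟩ := hsurj x
    obtain ⟨j, b, rfl⟩ := hsurj y
    refine ⟨_, ξ (IsCofiltered.min i j), P.map (IsCofiltered.minToLeft i j) ≫ a,
      P.map (IsCofiltered.minToRight i j) ≫ b, ?_, ?_⟩ <;> simp [hξ]
  · obtain ⟨i, a, rfl⟩ := hsurj x
    obtain ⟨k, φ, hk⟩ := hinj (a ≫ f) (a ≫ g) (by simpa using h)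
    have := hC (P.map φ ≫ a)
    rw [← cancel_epi (P.map φ ≫ a), Category.assoc, hk, Category.assoc]
  · have := hC f
    have : EffectiveEpi (F.map f) := inferInstance
    exact (epi_iff_surjective _).1 inferInstance

namespace IsGaloisFiber

variable {F : C ⥤ Type v} (hF : IsGaloisFiber F)

include hF

/-- Lift `F(f)(y)` along `F(g)` and dominate `y` and its lift by one element: the resulting square
commutes there, hence commutes. -/
lemma rightOre : GrothendieckTopology.RightOreCondition C := by
  intro X Y Z f g
  obtain ⟨y⟩ := hF.nonempty Y
  obtain ⟨z, hz⟩ := hF.surj g (F.map f y)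
  obtain ⟨W, w, a, b, rfl, rfl⟩ := hF.directed y z
  exact ⟨W, a, b, hF.unique w (by simpa using hz.symm)⟩

/-- Two elements of the same fibre of `F(f)` come from a pair of arrows equalized by `f`. -/
lemma exists_pair {X Y : C} (f : Y ⟶ X) {y y' : F.obj Y} (h : F.map f y = F.map f y') :
    ∃ (V : C) (v : F.obj V) (s t : V ⟶ Y), s ≫ f = t ≫ f ∧ F.map s v = y ∧ F.map t v = y' := by
  obtain ⟨V, v, s, t, rfl, rfl⟩ := hF.directed y y'
  exact ⟨V, v, s, t, hF.unique v (by simpa using h), rfl, rfl⟩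

end IsGaloisFiber

end Fiber

/-! ### Sheaves for the atomic topology -/

section Atomic

variable {C : Type u} [Category.{v} C] (hro : GrothendieckTopology.RightOreCondition C)

/-- The sheaf condition for the atomic topology only needs to be checked on single arrows. -/
lemma isSheaf_atomic_iff (P : Cᵒᵖ ⥤ Type v) :
    Presieve.IsSheaf (GrothendieckTopology.atomic hro) P ↔
      ∀ {X Y : C} (f : Y ⟶ X), (Presieve.singleton f).IsSheafFor P := by
  refine ⟨fun h X Y f => ?_, fun h X S => ?_⟩
  · rw [Presieve.isSheafFor_iff_generate]
    exact h _ ⟨Y, f, Sieve.le_generate _ _ _ ⟨⟩⟩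
  · rintro ⟨Y, f, hf⟩
    have inj {A B : C} (a : A ⟶ B) : Function.Injective (P.map a.op) :=
      Presieve.isSeparatedFor_singleton.1 (h a).isSeparatedFor
    intro x hx
    obtain ⟨p, hp, huniq⟩ := Presieve.isSheafFor_singleton.1 (h f) (x f hf)
      (fun {V} s t hst => hx s t hf hf hst)
    refine ⟨p, fun Z g hg => ?_, fun q hq => huniq q (hq f hf)⟩
    -- The section found over `f` is compared with the family at `g` on an Ore square, where
    -- restriction along `a` loses nothing.
    obtain ⟨W, a, b, hab⟩ := hro g f
    apply inj a
    have := hx a b hg hf hab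
    rw [this, ← hp, ← comp_apply, ← P.map_comp, ← comp_apply, ← P.map_comp, ← op_comp, ← op_comp,
      hab]

/-- Strict epimorphisms make the representables atomic sheaves. A canonical cover that is not atomic
is empty; if the empty sieve covers `X`, every object over `X` has exactly one arrow to each object.
Then any `X ⟶ Z` is a split monomorphism as well as a strict epimorphism, so all objects are
isomorphic to `X` and `C` is trivial. -/
lemma atomic_eq_canonicalTopology (hC : ∀ {Y X : C} (f : Y ⟶ X), EffectiveEpi f)
    (h1 : ¬ Nonempty (C ≌ Discrete PUnit.{1})) :
    GrothendieckTopology.atomic hro = Sheaf.canonicalTopology C := by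
  refine le_antisymm ?_ fun X S hS => ?_
  · have := GrothendieckTopology.Subcanonical.of_isSheaf_yoneda_obj
      (GrothendieckTopology.atomic hro) fun X => (isSheaf_atomic_iff hro _).2 fun f => by
        have := hC f
        exact Presieve.IsSheafFor.singleton_of_isRepresentable_of_effectiveEpi f _
    exact this.le_canonical
  · by_contra hS'
    have hbot : S = ⊥ := by
      refine le_bot_iff.1 fun Y f hf => hS' ⟨Y, f, hf⟩
    subst hbot
    have initial {Y : C} (f : Y ⟶ X) (Z : C) : Nonempty (Unique (Y ⟶ Z)) := by
      have hY : ⊥ ∈ Sheaf.canonicalTopology C Y := by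
        simpa using (Sheaf.canonicalTopology C).pullback_stable f hS
      have := Sheaf.isSheaf_yoneda_obj Z _ hY
      obtain ⟨t, -, ht⟩ := this (fun _ _ h => h.elim) (fun _ _ _ _ _ _ _ h => h.elim)
      exact ⟨⟨⟨t⟩, fun a => ht a fun _ _ h => h.elim⟩⟩
    have iso (Z : C) : ∃ f : X ⟶ Z, IsIso f := by
      obtain ⟨u⟩ := initial (𝟙 X) Z
      let f := u.default
      have := hC f
      have hf : f ≫ EffectiveEpi.desc f (𝟙 X) (fun {W} s t _ => by
          obtain ⟨uW⟩ := initial s X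
          rw [uW.uniq s, uW.uniq t]) = 𝟙 X := EffectiveEpi.fac _ _ _
      refine ⟨f, _, hf, ?_⟩
      rw [← cancel_epi f, reassoc_of% hf, Category.comp_id]
    refine h1 ⟨?_⟩
    have uniq (A B : C) : Nonempty (Unique (A ⟶ B)) := by
      obtain ⟨f, _⟩ := iso A
      exact initial (inv f) B
    have (A B : C) : Unique (A ⟶ B) := (uniq A B).some
    exact
      { functor := Functor.star C
        inverse := Functor.fromPUnit X
        unitIso := NatIso.ofComponents (fun A => ⟨default, default, Subsingleton.elim _ _,
          Subsingleton.elim _ _⟩) (fun _ => Subsingleton.elim _ _)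
        counitIso := Functor.punitExt _ _
        functor_unitIso_comp := fun _ => Subsingleton.elim _ _ }

end Atomic

end LocalicGalois

namespace LocalicGalois

/-! ### A dense description of the locale of automorphisms -/

section Dense

variable {C : Type u} [Category.{v} C] {F : C ⥤ Type v}

/-- The point `⟨X, (x, y)⟩` of `D_{ΔF}`. -/
abbrev relPt (X : C) (x y : F.obj X) : RelPoset F := ⟨X, (x, y)⟩

/-- A downward closed subset of `D_{ΔF}` is closed if it satisfies the sheaf condition for the
families `⟨W, (w₀, w)⟩ ⟶ ⟨Z, (z₀, z₁)⟩`, with `f : W ⟶ Z` and `F(f)(w₀) = z₀` fixed and `w` ranging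
over the fibre of `z₁`, and for their mirror images. -/
structure IsRelClosed (T : LowerSet (RelPoset F)) : Prop where
  left : ∀ {W Z : C} (f : W ⟶ Z) (w : F.obj W) (z : F.obj Z),
    (∀ w', F.map f w' = z → relPt W w w' ∈ T) → relPt Z (F.map f w) z ∈ T
  right : ∀ {W Z : C} (f : W ⟶ Z) (w : F.obj W) (z : F.obj Z),
    (∀ w', F.map f w' = z → relPt W w' w ∈ T) → relPt Z z (F.map f w) ∈ T

/-- The families are stable under base change: given `g` into `Z`, dominating `v` and `w` by one `u`
produces a family over `a : U ⟶ V` that refines the pullback of the original one. -/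
lemma IsGaloisFiber.himp_isRelClosed (hF : IsGaloisFiber F) (A T : LowerSet (RelPoset F))
    (hT : IsRelClosed T) : IsRelClosed (A ⇨ T) := by
  have key : ∀ w, w ∈ A ⇨ T ↔ ∀ w' ≤ w, w' ∈ A → w' ∈ T := by
    intro w
    rw [← LowerSet.Iic_le, le_himp_iff]
    exact ⟨fun h w' hw hA => h ⟨hw, hA⟩, fun h w' hw => h w' hw.1 hw.2⟩
  constructor
  · intro W Z f w z h
    rw [key]
    rintro ⟨V, v, v'⟩ ⟨g, h₁, h₂⟩ hA
    obtain ⟨U, u, a, b, rfl, rfl⟩ := hF.directed v w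
    have hab : a ≫ g = b ≫ f := hF.unique u (by simpa using h₁)
    refine hT.left a u v' fun u' hu' => (key _).1 (h (F.map b u') ?_) _ ⟨b, rfl, rfl⟩ ?_
    · rw [← comp_apply, ← F.map_comp, ← hab, F.map_comp, comp_apply, hu']
      exact h₂
    · exact A.lower ⟨a, rfl, hu'⟩ hA
  · intro W Z f w z h
    rw [key]
    rintro ⟨V, v', v⟩ ⟨g, h₂, h₁⟩ hA
    obtain ⟨U, u, a, b, rfl, rfl⟩ := hF.directed v w
    have hab : a ≫ g = b ≫ f := hF.unique u (by simpa using h₁)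
    refine hT.right a u v' fun u' hu' => (key _).1 (h (F.map b u') ?_) _ ⟨b, rfl, rfl⟩ ?_
    · rw [← comp_apply, ← F.map_comp, ← hab, F.map_comp, comp_apply, hu']
      exact h₂
    · exact A.lower ⟨a, hu', rfl⟩ hA

/-- The locale of closed downward closed subsets of `D_{ΔF}`. -/
def relSheaves (hF : IsGaloisFiber F) : Sublocale (LowerSet (RelPoset F)) where
  carrier := {T | IsRelClosed T}
  sInf_mem' A hA := by
    constructor
    · intro W Z f w z h
      simp only [LowerSet.mem_sInf_iff] at h ⊢
      exact fun T hT => (hA hT).left f w z fun w' hw' => h w' hw' T hT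
    · intro W Z f w z h
      simp only [LowerSet.mem_sInf_iff] at h ⊢
      exact fun T hT => (hA hT).right f w z fun w' hw' => h w' hw' T hT
  himp_mem' A T hT := hF.himp_isRelClosed A T hT

/-- Surjectivity of `F(f)` makes every covering family nonempty. -/
lemma IsGaloisFiber.isRelClosed_bot (hF : IsGaloisFiber F) :
    IsRelClosed (⊥ : LowerSet (RelPoset F)) where
  left f w z h := by
    obtain ⟨w', hw'⟩ := hF.surj f z
    exact (LowerSet.notMem_bot (h w' hw')).elim
  right f w z h := by
    obtain ⟨w', hw'⟩ := hF.surj f z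
    exact (LowerSet.notMem_bot (h w' hw')).elim

/-- An arrow which is constant on some fibre of `F(f)` factors through `f`. -/
lemma IsGaloisFiber.exists_desc (hF : IsGaloisFiber F) {W Y Z : C} (f : W ⟶ Z) (g : W ⟶ Y)
    (z : F.obj Z) (y : F.obj Y) (h : ∀ w, F.map f w = z → F.map g w = y) :
    ∃ k : Z ⟶ Y, f ≫ k = g := by
  have := hF.strict f
  refine ⟨EffectiveEpi.desc f g fun {V} s t hst => ?_, EffectiveEpi.fac _ _ _⟩
  -- At such a `v` both `F(s)(v)` and `F(t)(v)` lie in the fibre over `z`, where `F(g)` is constant.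
  obtain ⟨v, hv⟩ := hF.surj (s ≫ f) z
  refine hF.unique v ?_
  rw [F.map_comp, comp_apply, h _ (by simpa using hv), F.map_comp, comp_apply,
    h _ (by simpa [hst] using hv)]

/-- The topology is subcanonical: the arrows witnessing membership for the various `w'` agree at
`w`, so they are a single arrow `g`. It is constant on the fibre of `z`, hence descends along `f`.
-/
lemma IsGaloisFiber.isRelClosed_Iic (hF : IsGaloisFiber F) (p : RelPoset F) :
    IsRelClosed (LowerSet.Iic p) where
  left {W Z} f w z h := by
    obtain ⟨Y, y, y'⟩ := p
    obtain ⟨w', hw'⟩ := hF.surj f z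
    obtain ⟨g, h₁, h₂⟩ := h w' hw'
    obtain ⟨k, rfl⟩ := hF.exists_desc f g z y' fun w'' hw'' => by
      obtain ⟨g', h₁', h₂'⟩ := h w'' hw''
      obtain rfl : g = g' := hF.unique w (h₁.trans h₁'.symm)
      exact h₂'
    refine ⟨k, by simpa using h₁, ?_⟩
    simpa [← hw'] using h₂
  right {W Z} f w z h := by
    obtain ⟨Y, y', y⟩ := p
    obtain ⟨w', hw'⟩ := hF.surj f z
    obtain ⟨g, h₂, h₁⟩ := h w' hw'
    obtain ⟨k, rfl⟩ := hF.exists_desc f g z y' fun w'' hw'' => by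
      obtain ⟨g', h₂', h₁'⟩ := h w'' hw''
      obtain rfl : g = g' := hF.unique w (h₁.trans h₁'.symm)
      exact h₂'
    refine ⟨k, ?_, by simpa using h₁⟩
    simpa [← hw'] using h₂

/-- The closed subset of the elements below `p`. -/
def relSharp (hF : IsGaloisFiber F) (p : RelPoset F) : relSheaves hF :=
  ⟨LowerSet.Iic p, hF.isRelClosed_Iic p⟩

lemma relSharp_le {hF : IsGaloisFiber F} {p : RelPoset F} {T : relSheaves hF} :
    relSharp hF p ≤ T ↔ p ∈ T.1 :=
  LowerSet.Iic_le

lemma relSharp_map_le {hF : IsGaloisFiber F} {X Y : C} (f : X ⟶ Y) (x y : F.obj X) :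
    relSharp hF (relPt X x y) ≤ relSharp hF (relPt Y (F.map f x) (F.map f y)) :=
  relSharp_le.2 ⟨f, rfl, rfl⟩

/-- The automorphism of `F` with values in the locale of closed subsets of `D_{ΔF}`. -/
def relAut (hF : IsGaloisFiber F) : ValuedAut F (relSheaves hF) where
  val X x y := relSharp hF (relPt X x y)
  natural := relSharp_map_le
  univalued X x y z h := by
    refine bot_unique fun p hp => (h ?_).elim
    obtain ⟨f, h₁, h₂⟩ :=
      (inf_le_left : relSharp hF (relPt X z x) ⊓ relSharp hF (relPt X z y) ≤ _) hp
    obtain ⟨g, h₃, h₄⟩ :=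
      (inf_le_right : relSharp hF (relPt X z x) ⊓ relSharp hF (relPt X z y) ≤ _) hp
    obtain rfl : f = g := hF.unique p.2.1 (h₁.trans h₃.symm)
    exact h₂.symm.trans h₄
  injective X x y z h := by
    refine bot_unique fun p hp => (h ?_).elim
    obtain ⟨f, h₁, h₂⟩ :=
      (inf_le_left : relSharp hF (relPt X x z) ⊓ relSharp hF (relPt X y z) ≤ _) hp
    obtain ⟨g, h₃, h₄⟩ :=
      (inf_le_right : relSharp hF (relPt X x z) ⊓ relSharp hF (relPt X y z) ≤ _) hp
    obtain rfl : f = g := hF.unique p.2.2 (h₂.trans h₄.symm)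
    exact h₁.symm.trans h₃
  total X z := by
    refine top_unique fun p _ => ?_
    obtain ⟨Y, y, y'⟩ := p
    obtain ⟨W, w, f, g, rfl, rfl⟩ := hF.directed y z
    -- The point is covered along `f` by points of `W`, and each of these maps by `g` to a generator
    -- of the join.
    refine (⨆ x, relSharp hF (relPt X (F.map g w) x)).2.left f w y' fun w' _ => ?_
    exact relSharp_le.1 ((relSharp_map_le g w w').trans
      (le_iSup (fun x => relSharp hF (relPt X (F.map g w) x)) (F.map g w')))
  surjective X z := by
    refine top_unique fun p _ => ?_
    obtain ⟨Y, y', y⟩ := p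
    obtain ⟨W, w, f, g, rfl, rfl⟩ := hF.directed y z
    refine (⨆ x, relSharp hF (relPt X x (F.map g w))).2.right f w y' fun w' _ => ?_
    exact relSharp_le.1 ((relSharp_map_le g w' w).trans
      (le_iSup (fun x => relSharp hF (relPt X x (F.map g w))) (F.map g w')))

/-- The morphism classifying `relAut` sends the generator to a principal lower set, whereas `⊥` of
`relSheaves` is empty. -/
lemma IsGaloisFiber.lAutGen_ne_bot (hF : IsGaloisFiber F) (X : C) (x y : F.obj X) :
    lAutGen X x y ≠ ⊥ := by
  intro h
  have h' := classify_lAutGen (relAut hF) X x y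
  rw [h, map_bot] at h'
  have h'' : relSharp hF (relPt X x y) ≤ ⟨⊥, hF.isRelClosed_bot⟩ := by
    refine le_trans (le_of_eq ?_) bot_le
    exact h'.symm
  exact LowerSet.notMem_bot (relSharp_le.1 h'')

/-- The order of `D_{ΔF}` is reflected by the canonical map to `lAut(F)`. -/
lemma IsGaloisFiber.exists_hom_of_lAutGen_le (hF : IsGaloisFiber F) {X Y : C} {x x' : F.obj X}
    {y y' : F.obj Y} (h : lAutGen X x x' ≤ lAutGen Y y y') :
    ∃ f : X ⟶ Y, F.map f x = y ∧ F.map f x' = y' := by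
  have h' := OrderHomClass.mono (classify (relAut hF)) h
  rw [classify_lAutGen, classify_lAutGen] at h'
  exact relSharp_le.1 h'

end Dense

end LocalicGalois

namespace LocalicGalois

/-! ### Cancellation in products of locales -/

section Cancellation

universe w

variable {A B : Type w} [Order.Frame A] [Order.Frame B]

/-- A nonzero factor on the left can be cancelled from an inclusion of open rectangles. -/
lemma le_of_tensor_le_inr {a : A} {b c : B} (ha : a ≠ ⊥)
    (h : tensorInl (B := B) a ⊓ tensorInr b ≤ tensorInr c) : b ≤ c := by
  -- The union of the rectangles that are either empty on the left or contained in `c` on the right;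
  -- this is already a sheaf and contains `⊤ ⊗ c`.
  let T : Tensor A B := ⟨⟨{p | p.1 = ⊥ ∨ p.2 ≤ c}, fun p q hqp hp =>
    hp.imp (fun h => bot_unique (hqp.1.trans h.le)) hqp.2.trans⟩, by
      rintro _ _ (⟨S, b⟩ | ⟨a, S⟩) ⟨v₁, v₂⟩ hS
      · by_cases hb : b ⊓ v₂ ≤ c
        · exact Or.inr hb
        · refine Or.inl ?_
          change sSup S ⊓ v₁ = ⊥
          rw [sSup_inf_eq]
          exact bot_unique (iSup₂_le fun a ha => ((hS _ ⟨a, ha, rfl⟩).resolve_right hb).le)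
      · by_cases hb : a ⊓ v₁ = ⊥
        · exact Or.inl hb
        · refine Or.inr ?_
          change sSup S ⊓ v₂ ≤ c
          rw [sSup_inf_eq]
          exact iSup₂_le fun b hb' => (hS _ ⟨b, hb', rfl⟩).resolve_left hb⟩
  have hT : tensorInr c ≤ T := sharp_le.2 (Or.inr le_rfl)
  rw [← sharp_eq_inl_inf_inr] at h
  exact (sharp_le.1 (h.trans hT)).resolve_left ha

/-- A nonzero factor on the right can be cancelled from an inclusion of open rectangles. -/
lemma le_of_tensor_le_inl {a c : A} {b : B} (hb : b ≠ ⊥)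
    (h : tensorInl a ⊓ tensorInr b ≤ tensorInl (B := B) c) : a ≤ c := by
  -- Exchanging the two factors reduces to the previous case.
  have h' := OrderHomClass.mono (tensorDesc (tensorInr (A := B) (B := A)) tensorInl) h
  rw [map_inf, tensorDesc_inl, tensorDesc_inl, tensorDesc_inr, inf_comm] at h'
  exact le_of_tensor_le_inr hb h'

end Cancellation

/-! ### Actions of the localic group of automorphisms -/

section Actions

open MonoidalCategory CartesianMonoidalCategory MonObj

variable {C : Type u} [Category.{v} C] {F : C ⥤ Type v}

/-- The inverse image of the multiplication of `lAut(F)`. -/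
noncomputable def lAutMul (F : C ⥤ Type v) :
    FrameHom (LAutFrame F) (Tensor (LAutFrame F) (LAutFrame F)) :=
  invImage (μ[lAut F])

/-- The inverse image of the neutral element of `lAut(F)`. -/
noncomputable def lAutUnit (F : C ⥤ Type v) : FrameHom (LAutFrame F) (Set PUnit.{max u v + 1}) :=
  invImage (η[lAut F])

lemma lAutMul_lAutGen (X : C) (x y : F.obj X) :
    lAutMul F (lAutGen X x y) =
      ⨆ z, tensorInl (lAutGen X x z) ⊓ tensorInr (lAutGen X z y) := by
  simp only [← sharp_eq_inl_inf_inr]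
  exact invImage_mul F X x y

open Classical in
lemma lAutUnit_lAutGen (X : C) (x y : F.obj X) :
    lAutUnit F (lAutGen X x y) = if x = y then ⊤ else ⊥ :=
  congrArg (fun a => a.val X x y) (autOfHom_one F)

namespace GSet

variable (S : GSet.{v, u} (lAut F))

/-- The element `μ^*[<x | y>]` of the frame `lAut(F)`. -/
noncomputable def rel (x y : S.carrier) : LAutFrame F := S.act x y

lemma rel_univalued {x y z : S.carrier} (h : x ≠ y) : S.rel z x ⊓ S.rel z y = ⊥ :=
  (autOfHom S.action).univalued ⟨⟨⟩⟩ x y z h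

lemma rel_injective {x y z : S.carrier} (h : x ≠ y) : S.rel x z ⊓ S.rel y z = ⊥ :=
  (autOfHom S.action).injective ⟨⟨⟩⟩ x y z h

lemma iSup_rel_left (z : S.carrier) : ⨆ x, S.rel x z = ⊤ :=
  (autOfHom S.action).surjective ⟨⟨⟩⟩ z

lemma autOfHom_mul_comp_action :
    autOfHom (μ[lAut F] ≫ S.action) =
      autOfHom (fst (lAut F) (lAut F) ≫ S.action) * autOfHom (snd (lAut F) (lAut F) ≫ S.action) := by
  have := S.isMonHom_action
  rw [IsMonHom.mul_hom, autOfHom_comp, autOfHom_mul, ValuedAut.map_mul, ← autOfHom_comp,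
    ← autOfHom_comp, tensorHom_fst, tensorHom_snd]

lemma lAutMul_rel (x y : S.carrier) :
    lAutMul F (S.rel x y) = ⨆ z, tensorInl (S.rel x z) ⊓ tensorInr (S.rel z y) :=
  congrArg (fun a => a.val ⟨⟨⟩⟩ x y) S.autOfHom_mul_comp_action

lemma lAutUnit_rel_self (x : S.carrier) : lAutUnit F (S.rel x x) = ⊤ := by
  classical
  have := S.isMonHom_action
  have h : autOfHom (η[lAut F] ≫ S.action) = 1 := by rw [IsMonHom.one_hom, autOfHom_one]
  refine (congrArg (fun a => a.val ⟨⟨⟩⟩ x x) h).trans ?_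
  exact if_pos rfl

-- The entries of a row of `S.rel` are pairwise disjoint, so a nonzero element lies below at most
-- one. This replaces evaluation of group elements at points.
variable {S} in
lemma eq_of_le_rel {a : LAutFrame F} (ha : a ≠ ⊥) {x y y' : S.carrier} (h : a ≤ S.rel x y)
    (h' : a ≤ S.rel x y') : y = y' := by
  by_contra hne
  exact ha (bot_unique ((le_inf h h').trans (S.rel_univalued hne).le))

end GSet

section Fn

variable {S : GSet.{v, u} (lAut F)} {X Y : C}

/-- The function `FX → S` underlying a morphism of `G`-sets `μF(X) ⟶ S`. -/
def fn (h : (muF F).obj X ⟶ S) : F.obj X → S.carrier := h.toFun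

lemma lAutGen_le_rel (h : (muF F).obj X ⟶ S) (x y : F.obj X) :
    lAutGen X x y ≤ S.rel (fn h x) (fn h y) := by
  rw [← invImage_evalAut F X x y]
  exact h.act_le x y

lemma lAutGen_le_lAutGen (h : (muF F).obj X ⟶ (muF F).obj Y) (x y : F.obj X) :
    lAutGen X x y ≤ lAutGen (F := F) Y (fn h x) (fn h y) :=
  (lAutGen_le_rel h x y).trans (invImage_evalAut F Y _ _).le

lemma exists_fn_eq (k : F.obj X → S.carrier) (hk : ∀ x y, lAutGen X x y ≤ S.rel (k x) (k y)) :
    ∃ h : (muF F).obj X ⟶ S, fn h = k :=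
  ⟨⟨k, fun x y => (invImage_evalAut F X x y).le.trans (hk x y)⟩, rfl⟩

lemma fn_map_comp (f : Y ⟶ X) (h : (muF F).obj X ⟶ S) (y : F.obj Y) :
    fn ((muF F).map f ≫ h) y = fn h (F.map f y) := rfl

lemma fn_injective {h k : (muF F).obj X ⟶ S} (hk : fn h = fn k) : h = k :=
  GSet.Hom.ext hk

end Fn

/-- The relation `<F(f)(y) | x>` is covered by the relations `<y | y'>`, with `y'` in the fibre of
`x`. -/
lemma ValuedAut.val_le_iSup_fiber {H : Type*} [Order.Frame H] (a : ValuedAut F H) {X Y : C}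
    (f : Y ⟶ X) (y : F.obj Y) (x : F.obj X) :
    a.val X (F.map f y) x ≤ ⨆ (y' : F.obj Y) (_ : F.map f y' = x), a.val Y y y' := by
  rw [← inf_top_eq (a.val X (F.map f y) x), ← a.total Y y, inf_iSup_eq]
  refine iSup_le fun y' => ?_
  by_cases h : F.map f y' = x
  · exact inf_le_right.trans (le_iSup₂_of_le (f := fun y' _ => a.val Y y y') y' h le_rfl)
  · refine (inf_le_inf_left _ (a.natural f y y')).trans ?_
    rw [a.univalued X _ _ _ (Ne.symm h)]
    exact bot_le

/-! ### Stabilizers and morphisms out of the fibres -/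

namespace IsGaloisFiber

variable (hF : IsGaloisFiber F)

include hF

/-- The stabilizers of elements of fibres form a neighbourhood base of the unit: the unit kills `<x
| y>` for `x ≠ y`, so `U` is a finite meet of generators `<x | x>`, and directedness bounds it below
by one of them. -/
lemma exists_lAutGen_le_sharp (U : FreeInf (RelPoset F))
    (hU : lAutUnit F (sharp (AutCov F) U) ≠ ⊥) :
    ∃ (Z : C) (z : F.obj Z), lAutGen Z z z ≤ sharp (AutCov F) U := by
  induction U using FreeInf.induction with
  | top =>
    obtain ⟨Z⟩ := hF.inhabited
    obtain ⟨z⟩ := hF.nonempty Z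
    exact ⟨Z, z, by rw [sharp_top]; exact le_top⟩
  | inf p U ih =>
    obtain ⟨X, x, y⟩ := p
    rw [sharp_inf, map_inf] at hU
    obtain ⟨Z, z, hz⟩ := ih fun h => hU (by rw [h, inf_bot_eq])
    obtain rfl : x = y := by
      classical
      by_contra hxy
      refine hU ?_
      have := lAutUnit_lAutGen X x y
      rw [if_neg hxy] at this
      rw [show lAutUnit F (sharp (AutCov F) (FreeInf.gen ⟨X, x, y⟩)) = ⊥ from this, bot_inf_eq]
    obtain ⟨W, w, f, g, rfl, rfl⟩ := hF.directed x z
    refine ⟨W, w, ?_⟩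
    rw [sharp_inf]
    exact le_inf ((genericAut F).natural f w w) (((genericAut F).natural g w w).trans hz)

/-- The stabilizer of an element of a `G`-set contains the stabilizer of some element of some
`FZ`. -/
lemma exists_lAutGen_le_rel (S : GSet.{v, u} (lAut F)) (s : S.carrier) :
    ∃ (Z : C) (z : F.obj Z), lAutGen Z z z ≤ S.rel s s := by
  -- The unit sends the stabilizer, a join of basic opens, to `⊤`, so it cannot kill all of them.
  have h : ∃ U ∈ (S.rel s s).1, lAutUnit F (sharp (AutCov F) U) ≠ ⊥ := by
    by_contra! h
    have h' := S.lAutUnit_rel_self s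
    rw [eq_iSup_sharp (S.rel s s)] at h'
    simp only [map_iSup] at h'
    have h'' : (⊤ : Set PUnit.{max u v + 1}) ≤ ⊥ := by
      rw [← h']
      exact iSup₂_le fun U hU => (h U hU).le
    exact h'' (Set.mem_univ PUnit.unit)
  obtain ⟨U, hU, hU'⟩ := h
  obtain ⟨Z, z, hz⟩ := hF.exists_lAutGen_le_sharp U hU'
  exact ⟨Z, z, hz.trans (sharp_le.2 hU)⟩

/-- Pointwise: if `g z = z'` and `h z' = z`, then `h g` fixes `z`, hence `s`. Taking `h` with also
`h t = s`, injectivity of `h` forces `g s = t`. The nonzero open of such `h` is the right factor,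
which is then cancelled. -/
lemma exists_rel_of_lAutGen_le {S : GSet.{v, u} (lAut F)} {s : S.carrier} {Z : C} {z : F.obj Z}
    (h : lAutGen Z z z ≤ S.rel s s) (z' : F.obj Z) : ∃ t, lAutGen Z z z' ≤ S.rel s t := by
  obtain ⟨t, ht⟩ : ∃ t, lAutGen Z z' z ⊓ S.rel t s ≠ ⊥ := by
    by_contra! ht
    refine hF.lAutGen_ne_bot Z z' z ?_
    rw [← inf_top_eq (lAutGen Z z' z), ← S.iSup_rel_left s, inf_iSup_eq]
    exact bot_unique (iSup_le fun t => (ht t).le)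
  refine ⟨t, le_of_tensor_le_inl ht ?_⟩
  have h₁ : tensorInl (lAutGen Z z z') ⊓ tensorInr (lAutGen Z z' z) ≤
      ⨆ r, tensorInl (S.rel s r) ⊓ tensorInr (S.rel r s) := by
    rw [← S.lAutMul_rel]
    refine le_trans ?_ (OrderHomClass.mono (lAutMul F) h)
    rw [lAutMul_lAutGen]
    exact le_iSup (fun w => tensorInl (lAutGen Z z w) ⊓ tensorInr (lAutGen Z w z)) z'
  rw [map_inf, ← inf_assoc]
  refine (inf_le_inf_right _ h₁).trans ?_
  rw [iSup_inf_eq]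
  refine iSup_le fun r => ?_
  by_cases hr : r = t
  · subst hr
    exact inf_le_left.trans inf_le_left
  · rw [inf_assoc, ← map_inf, S.rel_injective hr, map_bot, inf_bot_eq]
    exact bot_le

/-- If the stabilizer of `z ∈ FZ` is contained in the stabilizer of `s ∈ S`, there is a morphism of
`G`-sets `FZ ⟶ S` which sends `z` to `s`. -/
lemma exists_hom_of_lAutGen_le_rel {S : GSet.{v, u} (lAut F)} {s : S.carrier} {Z : C}
    {z : F.obj Z} (h : lAutGen Z z z ≤ S.rel s s) :
    ∃ k : (muF F).obj Z ⟶ S, fn k z = s := by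
  choose k hk using hF.exists_rel_of_lAutGen_le h
  suffices hk' : ∀ x y, lAutGen Z x y ≤ S.rel (k x) (k y) by
    obtain ⟨k', rfl⟩ := exists_fn_eq k hk'
    exact ⟨k', GSet.eq_of_le_rel (hF.lAutGen_ne_bot Z z z) (hk z) h⟩
  intro x y
  -- Pointwise: if `g z = x` and `h x = y`, then `g s = k x` and `h g s = k y`, so `h (k x) = k y`;
  -- the nonzero open of such `g` is cancelled.
  refine le_of_tensor_le_inr (hF.lAutGen_ne_bot Z z x) ?_
  have h₁ : tensorInl (lAutGen Z z x) ⊓ tensorInr (lAutGen Z x y) ≤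
      ⨆ r, tensorInl (S.rel s r) ⊓ tensorInr (S.rel r (k y)) := by
    rw [← S.lAutMul_rel]
    refine le_trans ?_ (OrderHomClass.mono (lAutMul F) (hk y))
    rw [lAutMul_lAutGen]
    exact le_iSup (fun w => tensorInl (lAutGen Z z w) ⊓ tensorInr (lAutGen Z w y)) x
  refine (le_inf h₁ (inf_le_left.trans (OrderHomClass.mono tensorInl (hk x)))).trans ?_
  rw [iSup_inf_eq]
  refine iSup_le fun r => ?_
  by_cases hr : r = k x
  · subst hr
    exact inf_le_left.trans inf_le_right
  · rw [inf_right_comm, ← map_inf, S.rel_univalued hr, map_bot, bot_inf_eq]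
    exact bot_le

/-- Every element of a `G`-set is in the image of some `FZ`. -/
lemma exists_hom_apply_eq (S : GSet.{v, u} (lAut F)) (s : S.carrier) :
    ∃ (Z : C) (z : F.obj Z) (k : (muF F).obj Z ⟶ S), fn k z = s := by
  obtain ⟨Z, z, h⟩ := hF.exists_lAutGen_le_rel S s
  obtain ⟨k, hk⟩ := hF.exists_hom_of_lAutGen_le_rel h
  exact ⟨Z, z, k, hk⟩

/-- Since `<x | y>` is nonzero, the value at `x` determines the value at `y`. -/
lemma hom_ext {S : GSet.{v, u} (lAut F)} {X : C} {h k : (muF F).obj X ⟶ S} (x : F.obj X)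
    (hx : fn h x = fn k x) : h = k := by
  refine fn_injective (funext fun y => ?_)
  exact GSet.eq_of_le_rel (hF.lAutGen_ne_bot X x y) (hx ▸ lAutGen_le_rel h x y)
    (lAutGen_le_rel k x y)

/-- The functor `μF` is full. -/
lemma exists_map_eq {X Y : C} (h : (muF F).obj X ⟶ (muF F).obj Y) :
    ∃ f : X ⟶ Y, (muF F).map f = h := by
  obtain ⟨x⟩ := hF.nonempty X
  obtain ⟨f, hf, -⟩ := hF.exists_hom_of_lAutGen_le (lAutGen_le_lAutGen h x x)
  exact ⟨f, hF.hom_ext x hf⟩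

lemma muF_map_injective {X Y : C} {f g : X ⟶ Y} (h : (muF F).map f = (muF F).map g) : f = g := by
  obtain ⟨x⟩ := hF.nonempty X
  exact hF.unique x (congrArg (fun k => fn k x) h)

lemma nonemptyTransitive_muF (X : C) : GSet.nonemptyTransitive (lAut F) ((muF F).obj X) :=
  ⟨hF.nonempty X, fun x y h => hF.lAutGen_ne_bot X x y ((invImage_evalAut F X x y).symm.trans h)⟩

end IsGaloisFiber

end Actions

end LocalicGalois

namespace LocalicGalois

open Opposite

/-! ### The sheaf of morphisms from the fibres to a `G`-set -/

section HomSheaf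

variable {C : Type u} [Category.{v} C] {F : C ⥤ Type v}

variable (F) in
/-- The functor `S ↦ ℬG(μF(-), S)`. -/
noncomputable def homPresheaf : GSet.{v, u} (lAut F) ⥤ Cᵒᵖ ⥤ Type v :=
  yoneda ⋙ (Functor.whiskeringLeft Cᵒᵖ (GSet.{v, u} (lAut F))ᵒᵖ (Type v)).obj (muF F).op

namespace IsGaloisFiber

variable (hF : IsGaloisFiber F)

include hF

/-- A morphism of `G`-sets which equalizes the kernel pairs of `f` descends along `F(f)`. -/
lemma exists_map_comp_eq {S : GSet.{v, u} (lAut F)} {X Y : C} (f : Y ⟶ X)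
    (h : (muF F).obj Y ⟶ S)
    (hh : ∀ {V : C} (s t : V ⟶ Y), s ≫ f = t ≫ f → (muF F).map s ≫ h = (muF F).map t ≫ h) :
    ∃ k : (muF F).obj X ⟶ S, (muF F).map f ≫ k = h := by
  have fac {y y' : F.obj Y} (hy : F.map f y = F.map f y') : fn h y = fn h y' := by
    obtain ⟨V, v, s, t, hst, rfl, rfl⟩ := hF.exists_pair f hy
    exact congrArg (fun k => fn k v) (hh s t hst)
  let σ := Function.surjInv (hF.surj f)
  have hσ (x : F.obj X) : F.map f (σ x) = x := Function.surjInv_eq (hF.surj f) x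
  obtain ⟨k, hk⟩ := exists_fn_eq (S := S) (fun x => fn h (σ x)) fun x x' => by
    -- The section `σ` need not be equivariant, but `<x | x'>` is covered by `<σ x | y'>` with `y'`
    -- over `x'`, and there `h` takes the same value at `y'` and at `σ x'`.
    have := (genericAut F).val_le_iSup_fiber f (σ x) x'
    rw [hσ] at this
    refine this.trans (iSup₂_le fun y' hy' => (lAutGen_le_rel h _ _).trans ?_)
    rw [fac (hy'.trans (hσ x').symm)]
  refine ⟨k, fn_injective (funext fun y => ?_)⟩
  rw [fn_map_comp, hk]
  exact fac (hσ _)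

lemma map_comp_injective {S : GSet.{v, u} (lAut F)} {X Y : C} (f : Y ⟶ X)
    {h k : (muF F).obj X ⟶ S} (hhk : (muF F).map f ≫ h = (muF F).map f ≫ k) : h = k := by
  obtain ⟨y⟩ := hF.nonempty Y
  exact hF.hom_ext (F.map f y) (congrArg (fun k => fn k y) hhk)

lemma isSheaf_homPresheaf (S : GSet.{v, u} (lAut F)) :
    Presheaf.IsSheaf (GrothendieckTopology.atomic hF.rightOre) ((homPresheaf F).obj S) := by
  rw [isSheaf_iff_isSheaf_of_type, isSheaf_atomic_iff]
  intro X Y f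
  rw [Presieve.isSheafFor_singleton]
  intro h hh
  obtain ⟨k, hk⟩ := hF.exists_map_comp_eq f h hh
  exact ⟨k, hk, fun k' hk' => hF.map_comp_injective f (hk'.trans hk.symm)⟩

omit hF in
/-- The functor `S ↦ ℬG(μF(-), S)`, with values in the sheaves for the atomic topology. -/
noncomputable def homSheaf (hF : IsGaloisFiber F) :
    GSet.{v, u} (lAut F) ⥤ Sheaf (GrothendieckTopology.atomic hF.rightOre) (Type v) :=
  ObjectProperty.lift _ (homPresheaf F) hF.isSheaf_homPresheaf

/-- The morphisms `FZ ⟶ S` are jointly surjective. -/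
lemma homPresheaf_map_injective {S T : GSet.{v, u} (lAut F)} {h k : S ⟶ T}
    (hhk : (homPresheaf F).map h = (homPresheaf F).map k) : h = k := by
  refine GSet.Hom.ext (funext fun s => ?_)
  obtain ⟨Z, z, p, rfl⟩ := hF.exists_hom_apply_eq S s
  have : p ≫ h = p ≫ k := ConcreteCategory.congr_hom (NatTrans.congr_app hhk (op Z)) p
  exact congrArg (fun q => fn q z) this

/-- Write `s = h(x)` with `h : FX ⟶ S` and send it to `φ(h)(x)`. Two presentations of `s` become
equal on a common refinement, so naturality of `φ` makes this well defined. -/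
lemma exists_homPresheaf_map_eq {S T : GSet.{v, u} (lAut F)}
    (φ : (homPresheaf F).obj S ⟶ (homPresheaf F).obj T) :
    ∃ k : S ⟶ T, (homPresheaf F).map k = φ := by
  let Φ {X : C} (h : (muF F).obj X ⟶ S) : (muF F).obj X ⟶ T := φ.app (op X) h
  have hΦ {X Y : C} (f : Y ⟶ X) (h : (muF F).obj X ⟶ S) :
      Φ ((muF F).map f ≫ h) = (muF F).map f ≫ Φ h :=
    ConcreteCategory.congr_hom (φ.naturality f.op) h
  have wd {X Y : C} (h : (muF F).obj X ⟶ S) (x : F.obj X) (k : (muF F).obj Y ⟶ S) (y : F.obj Y)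
      (hxy : fn h x = fn k y) : fn (Φ h) x = fn (Φ k) y := by
    obtain ⟨Z, z, f, g, rfl, rfl⟩ := hF.directed x y
    have : (muF F).map f ≫ h = (muF F).map g ≫ k := hF.hom_ext z hxy
    rw [← fn_map_comp, ← fn_map_comp, ← hΦ, ← hΦ, this]
  choose Z z p hp using hF.exists_hom_apply_eq S
  refine ⟨⟨fun s => fn (Φ (p s)) (z s), fun s s' => ?_⟩, ?_⟩
  · change S.rel s s' ≤ T.rel (fn (Φ (p s)) (z s)) (fn (Φ (p s')) (z s'))
    -- Split `<s | s'>` by the image `y` of the chosen `z s`: the piece is zero unless `y` lies over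
    -- `s'`, and then `y` may replace the chosen representative of `s'`.
    rw [← inf_top_eq (S.rel s s'), ← (genericAut F).total (Z s) (z s), inf_iSup_eq]
    refine iSup_le fun y => ?_
    change S.rel s s' ⊓ lAutGen (Z s) (z s) y ≤ _
    have hy := lAutGen_le_rel (p s) (z s) y
    rw [hp] at hy
    by_cases h : fn (p s) y = s'
    · rw [← wd (p s) y (p s') (z s') (h.trans (hp s').symm)]
      exact inf_le_right.trans (lAutGen_le_rel _ _ _)
    · refine (inf_le_inf_left _ hy).trans ?_
      rw [S.rel_univalued (Ne.symm h)]
      exact bot_le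
  · ext X h
    refine fn_injective (X := X.unop) (funext fun x => ?_)
    exact wd _ _ h x (hp _)

end IsGaloisFiber

end HomSheaf

end LocalicGalois

namespace LocalicGalois

open Opposite

/-! ### The `G`-set associated with a sheaf -/

section Stalk

open MonoidalCategory CartesianMonoidalCategory MonObj

variable {C : Type u} [Category.{v} C] {F : C ⥤ Type v}

/-- Being a sheaf for the atomic topology of `C`. -/
def IsGaloisFiber.IsAtomicSheaf (hF : IsGaloisFiber F) (P : Cᵒᵖ ⥤ Type v) : Prop :=
  Presieve.IsSheaf (GrothendieckTopology.atomic hF.rightOre) P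

/-- The relation on pairs of an element of `FX` and an element of `PX` whose quotient is the colimit
of `P` over the category of elements of `F`. -/
def stalkSetoid (hF : IsGaloisFiber F) (P : Cᵒᵖ ⥤ Type v) :
    Setoid (Σ X : C, F.obj X × P.obj (op X)) where
  r a b := ∃ (Z : C) (z : F.obj Z) (f : Z ⟶ a.1) (g : Z ⟶ b.1), F.map f z = a.2.1 ∧
    F.map g z = b.2.1 ∧ P.map f.op a.2.2 = P.map g.op b.2.2
  iseqv :=
    { refl := fun a => ⟨a.1, a.2.1, 𝟙 _, 𝟙 _, by simp, by simp, rfl⟩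
      symm := fun ⟨Z, z, f, g, h₁, h₂, h₃⟩ => ⟨Z, z, g, f, h₂, h₁, h₃.symm⟩
      trans := by
        rintro ⟨X, x, p⟩ ⟨Y, y, q⟩ ⟨X', x', p'⟩ ⟨Z, z, f, g, h₁, h₂, h₃⟩ ⟨Z', z', g', f', h₄, h₅, h₆⟩
        obtain ⟨W, w, a, b, rfl, rfl⟩ := hF.directed z z'
        dsimp only at f g g' f' h₁ h₂ h₃ h₄ h₅ h₆
        have hab : a ≫ g = b ≫ g' := hF.unique w (by simp [h₂, h₄])
        refine ⟨W, w, a ≫ f, b ≫ f', by simp [h₁], by simp [h₅], ?_⟩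
        dsimp only
        rw [op_comp, P.map_comp, comp_apply, h₃, op_comp, P.map_comp, comp_apply, ← h₆,
          ← comp_apply, ← P.map_comp, ← op_comp, hab, op_comp, P.map_comp, comp_apply] }

variable [Small.{v} C] (hF : IsGaloisFiber F) (P : Cᵒᵖ ⥤ Type v)

/-- The colimit of `P` over the category of elements of `F`. -/
def Stalk : Type v := Shrink.{v} (Quotient (stalkSetoid hF P))

variable {P}

/-- The element of the stalk represented by `p ∈ PX` at the point `x ∈ FX`. -/
noncomputable def germ {X : C} (x : F.obj X) (p : P.obj (op X)) : Stalk hF P :=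
  equivShrink _ (Quotient.mk (stalkSetoid hF P) ⟨X, x, p⟩)

variable {hF}

lemma germ_eq_germ_iff {X Y : C} {x : F.obj X} {p : P.obj (op X)} {y : F.obj Y}
    {q : P.obj (op Y)} : germ hF x p = germ hF y q ↔
      ∃ (Z : C) (z : F.obj Z) (f : Z ⟶ X) (g : Z ⟶ Y), F.map f z = x ∧ F.map g z = y ∧
        P.map f.op p = P.map g.op q :=
  ((equivShrink _).injective.eq_iff).trans Quotient.eq

lemma germ_map {X Y : C} (f : Y ⟶ X) (y : F.obj Y) (p : P.obj (op X)) :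
    germ hF y (P.map f.op p) = germ hF (F.map f y) p :=
  germ_eq_germ_iff.2 ⟨Y, y, 𝟙 _, f, by simp, rfl, by simp⟩

lemma exists_germ_eq (s : Stalk hF P) :
    ∃ (X : C) (x : F.obj X) (p : P.obj (op X)), germ hF x p = s := by
  obtain ⟨a, rfl⟩ := (equivShrink _).surjective s
  obtain ⟨⟨X, x, p⟩, rfl⟩ := Quotient.exists_rep a
  exact ⟨X, x, p, rfl⟩

variable (hP : hF.IsAtomicSheaf P)

-- The two arrows exhibiting equality of germs at the same `x` coincide, and a sheaf is separated
-- for that arrow.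
include hP in
lemma germ_injective {X : C} {x : F.obj X} {p q : P.obj (op X)}
    (h : germ hF x p = germ hF x q) : p = q := by
  obtain ⟨Z, z, f, g, h₁, h₂, h₃⟩ := germ_eq_germ_iff.1 h
  obtain rfl : f = g := hF.unique z (h₁.trans h₂.symm)
  exact Presieve.isSeparatedFor_singleton.1
    ((isSheaf_atomic_iff _ P).1 hP f).isSeparatedFor h₃

/-! ### The action on the stalk -/

variable {H : Type*} [Order.Frame H] (a b : ValuedAut F H)

/-- The relation `<s | t>` of the automorphism of the stalk of `P` induced by an automorphism
of `F`. -/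
def stalkVal (s t : Stalk hF P) : H :=
  ⨆ (X : C) (p : P.obj (op X)) (x : F.obj X) (y : F.obj X) (_ : germ hF x p = s)
    (_ : germ hF y p = t), a.val X x y

lemma val_le_stalkVal {X : C} (p : P.obj (op X)) (x y : F.obj X) :
    a.val X x y ≤ stalkVal a (germ hF x p) (germ hF y p) :=
  le_iSup_of_le X (le_iSup_of_le p (le_iSup_of_le x (le_iSup_of_le y
    (le_iSup_of_le rfl (le_iSup_of_le rfl le_rfl)))))

variable {a} in
lemma stalkVal_le {s t : Stalk hF P} {c : H}
    (h : ∀ (X : C) (p : P.obj (op X)) (x y : F.obj X), germ hF x p = s → germ hF y p = t →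
      a.val X x y ≤ c) : stalkVal a s t ≤ c :=
  iSup_le fun X => iSup_le fun p => iSup_le fun x => iSup_le fun y => iSup_le fun hx =>
    iSup_le fun hy => h X p x y hx hy

lemma stalkVal_inv_le (s t : Stalk hF P) : stalkVal a⁻¹ s t ≤ stalkVal a t s :=
  stalkVal_le fun X p x y hx hy => by
    subst hx hy
    exact val_le_stalkVal a p y x

lemma stalkVal_inv (s t : Stalk hF P) : stalkVal a⁻¹ s t = stalkVal a t s := by
  refine le_antisymm (stalkVal_inv_le a s t) ?_
  have := stalkVal_inv_le a⁻¹ t s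
  rwa [inv_inv] at this

lemma iSup_stalkVal (s : Stalk hF P) : ⨆ t, stalkVal a s t = ⊤ := by
  obtain ⟨X, x, p, rfl⟩ := exists_germ_eq s
  refine top_unique ?_
  rw [← a.total X x]
  exact iSup_le fun y => le_iSup_of_le (germ hF y p) (val_le_stalkVal a p x y)

lemma iSup_stalkVal_left (s : Stalk hF P) : ⨆ t, stalkVal a t s = ⊤ := by
  simp only [← stalkVal_inv a]
  exact iSup_stalkVal a⁻¹ s

include hP

/-- The induced automorphism of the stalk can be computed with any representative. -/
lemma stalkVal_germ {X : C} (x : F.obj X) (p : P.obj (op X)) (t : Stalk hF P) :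
    stalkVal a (germ hF x p) t = ⨆ (y : F.obj X) (_ : germ hF y p = t), a.val X x y := by
  refine le_antisymm (stalkVal_le fun Y q y y' h h' => ?_)
    (iSup₂_le fun y hy => hy ▸ val_le_stalkVal a p x y)
  -- On `Z` the restrictions of `p` and `q` coincide, so `<y | y'>` can be expanded over the fibres
  -- of `F(g)` and pushed forward along `f`.
  obtain ⟨Z, z, f, g, rfl, rfl⟩ := hF.directed x y
  have hpq : P.map f.op p = P.map g.op q := germ_injective hP (x := z) (by
    rw [germ_map, germ_map, h])
  refine (a.val_le_iSup_fiber g z y').trans (iSup₂_le fun z' hz' => ?_)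
  refine (a.natural f z z').trans ?_
  refine le_iSup₂_of_le (f := fun y _ => a.val X (F.map f z) y) (F.map f z') ?_ le_rfl
  rw [← germ_map, hpq, germ_map, hz', h']

lemma stalkVal_univalued {s t t' : Stalk hF P} (h : t ≠ t') :
    stalkVal a s t ⊓ stalkVal a s t' = ⊥ := by
  obtain ⟨X, x, p, rfl⟩ := exists_germ_eq s
  rw [stalkVal_germ hP, stalkVal_germ hP, iSup₂_inf_eq]
  refine bot_unique (iSup₂_le fun y hy => ?_)
  rw [inf_iSup₂_eq]
  refine iSup₂_le fun y' hy' => ?_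
  rw [a.univalued X]
  rintro rfl
  exact h (hy.symm.trans hy')

lemma stalkVal_injective {s s' t : Stalk hF P} (h : s ≠ s') :
    stalkVal a s t ⊓ stalkVal a s' t = ⊥ := by
  rw [← stalkVal_inv a t s, ← stalkVal_inv a t s']
  exact stalkVal_univalued hP a⁻¹ h

omit hP in
/-- The automorphism of the stalk of a sheaf `P` induced by an automorphism of `F`. -/
def stalkAut (hP : hF.IsAtomicSheaf P)
    (a : ValuedAut F H) : ValuedAut (Functor.fromPUnit.{u} (Stalk hF P)) H where
  val _ s t := stalkVal a s t
  natural _ _ _ := le_rfl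
  univalued _ _ _ _ h := stalkVal_univalued hP a h
  injective _ _ _ _ h := stalkVal_injective hP a h
  total _ s := iSup_stalkVal a s
  surjective _ s := iSup_stalkVal_left a s

lemma stalkAut_one : stalkAut hP (1 : ValuedAut F H) = 1 := by
  classical
  ext Y s t
  change stalkVal 1 (P := P) (hF := hF) s t = if s = t then ⊤ else ⊥
  obtain ⟨X, x, p, rfl⟩ := exists_germ_eq (hF := hF) s
  rw [stalkVal_germ hP]
  split_ifs with h
  · exact top_unique (le_iSup₂_of_le x h (by simp [ValuedAut.one_val]))
  · refine bot_unique (iSup₂_le fun y hy => ?_)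
    rw [ValuedAut.one_val, if_neg]
    rintro rfl
    exact h hy

/-- With a representative `p` fixed, only the intermediate germs `germ hF z p` contribute, and the
formula becomes composition of relations on `FX`. -/
lemma stalkAut_mul : stalkAut hP (a * b) = stalkAut hP a * stalkAut hP b := by
  ext Y s t
  change stalkVal (a * b) (P := P) (hF := hF) s t = ⨆ r : Stalk hF P, stalkVal a s r ⊓ stalkVal b r t
  obtain ⟨X, x, p, rfl⟩ := exists_germ_eq (hF := hF) s
  refine le_antisymm ?_ (iSup_le fun r => ?_)
  · rw [stalkVal_germ hP]
    refine iSup₂_le fun y hy => iSup_le fun z => le_iSup_of_le (germ hF z p) ?_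
    exact inf_le_inf (val_le_stalkVal a p x z) (hy ▸ val_le_stalkVal b p z y)
  · rw [stalkVal_germ hP, iSup₂_inf_eq]
    refine iSup₂_le fun z hz => ?_
    subst hz
    rw [stalkVal_germ hP, stalkVal_germ hP, inf_iSup₂_eq]
    refine iSup₂_le fun y hy => le_iSup₂_of_le (f := fun y _ => (a * b).val X x y) y hy ?_
    exact le_iSup (fun z => a.val X x z ⊓ b.val X z y) z

/-- Naturality in the frame: with `stalkAut_one` and `stalkAut_mul` it yields, by the Yoneda
principle, a morphism of localic groups. -/
lemma stalkAut_map {K : Type*} [Order.Frame K] (φ : FrameHom H K) :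
    stalkAut hP (a.map φ) = (stalkAut hP a).map φ := by
  ext Y s t
  change stalkVal (a.map φ) (P := P) (hF := hF) s t = φ (stalkVal a s t)
  simp only [stalkVal, map_iSup]
  rfl

omit hP in
/-- The action of `lAut(F)` on the stalk of a sheaf. -/
noncomputable def stalkAction (hP : hF.IsAtomicSheaf P) :
    lAut F ⟶ lAutSet.{v, u} (Stalk hF P) :=
  ofInvImage (classify (stalkAut hP (genericAut F)))

lemma autOfHom_comp_stalkAction {H : LocalicSpace.{max u v}} (f : H ⟶ lAut F) :
    autOfHom (f ≫ stalkAction hP) = stalkAut hP (autOfHom f) := by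
  refine Eq.trans ?_ (stalkAut_map hP (genericAut F) (invImage f)).symm
  exact ValuedAut.ext (funext fun Y => funext fun x => funext fun y =>
    congrArg (invImage f) (classify_lAutGen (stalkAut hP (genericAut F)) Y x y))

lemma isMonHom_stalkAction : IsMonHom (stalkAction hP) where
  one_hom := autOfHom_injective (by
    rw [autOfHom_comp_stalkAction, autOfHom_one, autOfHom_one, stalkAut_one])
  mul_hom := autOfHom_injective (by
    rw [autOfHom_comp_stalkAction, autOfHom_mul, autOfHom_comp, autOfHom_mul, ValuedAut.map_mul,
      ← autOfHom_comp, ← autOfHom_comp, tensorHom_fst, tensorHom_snd, autOfHom_comp_stalkAction,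
      autOfHom_comp_stalkAction, stalkAut_mul])

omit hP in
/-- The stalk of a sheaf as a `G`-set. -/
noncomputable def stalkGSet (hP : hF.IsAtomicSheaf P) :
    GSet.{v, u} (lAut F) where
  carrier := Stalk hF P
  action := stalkAction hP
  isMonHom_action := isMonHom_stalkAction hP

lemma rel_stalkGSet (s t : Stalk hF P) :
    (stalkGSet hP).rel s t = stalkVal (genericAut F) s t :=
  classify_lAutGen (stalkAut hP (genericAut F)) ⟨⟨⟩⟩ s t

/-- The sections of `P` over `X` are the morphisms of `G`-sets from `FX` to the stalk of `P`. -/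
lemma exists_germ_hom {X : C} (p : P.obj (op X)) :
    ∃ h : (muF F).obj X ⟶ stalkGSet hP, ∀ x, fn h x = germ hF x p := by
  obtain ⟨h, hh⟩ := exists_fn_eq (S := stalkGSet hP) (fun x => germ hF x p) fun x y =>
    (val_le_stalkVal (genericAut F) p x y).trans (rel_stalkGSet hP _ _).ge
  exact ⟨h, congrFun hh⟩

/-- The morphism `FX ⟶ S` to the stalk of `P` determined by a section of `P` over `X`. -/
noncomputable def germHom {X : C} (p : P.obj (op X)) : (muF F).obj X ⟶ stalkGSet hP :=
  (exists_germ_hom hP p).choose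

lemma fn_germHom {X : C} (p : P.obj (op X)) (x : F.obj X) : fn (germHom hP p) x = germ hF x p :=
  (exists_germ_hom hP p).choose_spec x

/-- For surjectivity, `h(x)` is the germ of a section `q` at some `y`. On a common refinement `f : Z
⟶ X` the restriction of `q` induces the restriction of `h`, so it is a matching section and descends
to `X`. -/
lemma germHom_bijective (X : C) :
    Function.Bijective (germHom hP : P.obj (op X) → ((muF F).obj X ⟶ stalkGSet hP)) := by
  constructor
  · intro p q h
    obtain ⟨x⟩ := hF.nonempty X
    refine germ_injective hP (x := x) ?_
    rw [← fn_germHom hP, ← fn_germHom hP, h]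
  · intro h
    obtain ⟨x⟩ := hF.nonempty X
    obtain ⟨Y, y, q, hq⟩ := exists_germ_eq (hF := hF) (fn h x)
    obtain ⟨Z, z, f, g, rfl, rfl⟩ := hF.directed x y
    have hr : (muF F).map f ≫ h = germHom hP (P.map g.op q) := hF.hom_ext z (by
      rw [fn_germHom, germ_map, hq, fn_map_comp])
    have hr' (z' : F.obj Z) : germ hF z' (P.map g.op q) = fn h (F.map f z') := by
      rw [← fn_germHom hP, ← hr, fn_map_comp]
    obtain ⟨p, hp, -⟩ := Presieve.isSheafFor_singleton.1 ((isSheaf_atomic_iff _ P).1 hP f)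
      (P.map g.op q) fun {V} s t hst => by
        obtain ⟨v⟩ := hF.nonempty V
        refine germ_injective hP (x := v) ?_
        rw [germ_map s, germ_map t, hr', hr', ← comp_apply, ← F.map_comp, hst, F.map_comp, comp_apply]
    refine ⟨p, hF.hom_ext (F.map f z) ?_⟩
    rw [fn_germHom, ← germ_map, hp, hr']

lemma map_comp_germHom {X Y : C} (f : Y ⟶ X) (p : P.obj (op X)) :
    (muF F).map f ≫ germHom hP p = germHom hP (P.map f.op p) :=
  fn_injective (funext fun y => by rw [fn_map_comp, fn_germHom, fn_germHom, germ_map])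

/-- A sheaf is recovered from its stalk. -/
noncomputable def germIso : P ≅ (homPresheaf F).obj (stalkGSet hP) :=
  NatIso.ofComponents (fun X => (Equiv.ofBijective _ (germHom_bijective hP X.unop)).toIso)
    (fun {X Y} f => by
      ext p
      exact (map_comp_germHom hP f.unop p).symm)

end Stalk

end LocalicGalois

namespace LocalicGalois

open Opposite

/-! ### The equivalence between sheaves and `G`-sets -/

section Equivalence

variable {C : Type u} [Category.{v} C] {F : C ⥤ Type v} (hF : IsGaloisFiber F)

lemma IsGaloisFiber.isEquivalence_homSheaf [Small.{v} C] : hF.homSheaf.IsEquivalence where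
  faithful := ⟨fun h => hF.homPresheaf_map_injective (congrArg (fun k => k.hom) h)⟩
  full := ⟨fun φ => by
    obtain ⟨k, hk⟩ := hF.exists_homPresheaf_map_eq φ.hom
    exact ⟨k, ObjectProperty.hom_ext _ hk⟩⟩
  essSurj := ⟨fun P => by
    have hP : hF.IsAtomicSheaf P.obj := (isSheaf_iff_isSheaf_of_type _ _).1 P.property
    exact ⟨stalkGSet hP, ⟨(fullyFaithfulSheafToPresheaf
      (GrothendieckTopology.atomic hF.rightOre) (Type v)).preimageIso
        (X := hF.homSheaf.obj (stalkGSet hP)) (Y := P) (germIso hP).symm⟩⟩⟩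

/-- The functor `μF` is fully faithful. -/
noncomputable def IsGaloisFiber.fullyFaithfulMuF : (muF F).FullyFaithful :=
  haveI : (muF F).Full := ⟨hF.exists_map_eq⟩
  haveI : (muF F).Faithful := ⟨hF.muF_map_injective⟩
  Functor.FullyFaithful.ofFullyFaithful _

lemma IsGaloisFiber.inducesEquivalence [Small.{v} C] :
    InducesEquivalence (GrothendieckTopology.atomic hF.rightOre) (muF F) := by
  have := hF.isEquivalence_homSheaf
  -- The inverse is `homSheaf` by construction; the remaining isomorphism is full faithfulness of
  -- `muF F`.
  refine ⟨hF.homSheaf.asEquivalence.symm, ⟨Iso.refl _⟩, ⟨Iso.symm ?_⟩⟩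
  refine NatIso.ofComponents (fun X => NatIso.ofComponents
    (fun Y => (hF.fullyFaithfulMuF.homEquiv (X := Y.unop) (Y := X)).toIso) fun {Y Z} g => ?_)
    fun {X X'} g => ?_
  · ext f
    exact (muF F).map_comp g.unop f
  · ext Y f
    exact (muF F).map_comp f g

instance small_freeInf {P : Type*} [Preorder P] [Small.{v} P] : Small.{v} (FreeInf P) :=
  small_of_injective (f := fun U : FreeInf P => (U.1 : Set P))
    fun _ _ h => Subtype.ext (SetLike.coe_injective h)

instance small_lAutFrame [Small.{v} C] : Small.{v} (LAutFrame F) := by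
  have : Small.{v} (RelPoset F) := inferInstanceAs (Small.{v} (Σ X : C, F.obj X × F.obj X))
  exact small_of_injective (f := fun T : LAutFrame F => (T.1 : Set (FreeInf (RelPoset F))))
    fun _ _ h => Subtype.ext (SetLike.coe_injective h)

end Equivalence

end LocalicGalois

theorem mainTheorem2 {C : Type u} [Category.{v} C] (F : C ⥤ Type v)
    (hF : IsProrepresentable F)
    (hC : ∀ {Y X : C} (f : Y ⟶ X), EffectiveEpi f)
    (hne : ∀ X : C, Nonempty (F.obj X))
    (hepi : F.PreservesEffectiveEpis) :
    (∀ X : C, GSet.nonemptyTransitive (lAut F) ((muF F).obj X)) ∧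
    (Small.{v} C →
      Small.{v} (lAut F).unop ∧
      (¬ Nonempty (C ≌ Discrete PUnit.{1}) →
        InducesEquivalence (Sheaf.canonicalTopology C) (muF F)) ∧
      ∃ hro : GrothendieckTopology.RightOreCondition C,
        InducesEquivalence (GrothendieckTopology.atomic hro) (muF F)) := by
  have hF' := IsGaloisFiber.of_isProrepresentable hF hC hne hepi
  refine ⟨hF'.nonemptyTransitive_muF, fun _ => ⟨small_lAutFrame, fun h1 => ?_, hF'.rightOre,
    hF'.inducesEquivalence⟩⟩
  rw [← atomic_eq_canonicalTopology hF'.rightOre hC h1]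
  exact hF'.inducesEquivalence
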